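/- Let $B_n$ be the braid group on $n$ strands, $B_n\to S_n$ the usual homomorphism, $PB_n$ its kernel, and $B_n[4]$ the kernel of the composition $B_n\to \mathrm{GL}_n(\mathbb Z[t,t^{-1}])\to \mathrm{GL}_n(\mathbb Z)\to \mathrm{GL}_n(\mathbb Z/4)$ of the unreduced Burau representation, evaluation at $t=-1$, and reduction modulo $4$. Put $\mathcal Z_n=B_n/B_n[4]$ and let $\mathcal{PZ}_n$ be the image of $PB_n$ in $\mathcal Z_n$. All representations are over $\mathbb C$. Let $[n]=\{1,\dots,n\}$ and let $[n]^{\underline 2}$ be the set of unordered pairs of distinct elements of $[n]$. A subset $I\subseteq[n]^{\underline 2}$ is *full* if the union of its elements is $[n]$. For each $m\ge 0$ let $\mathbb I_m$ be a set of representatives of the $S_m$-orbits of full subsets of $[m]^{\underline 2}$. For $I\subseteq [n]^{\underline 2}$ let $B_n^I$ be the stabilizer of $I$ in $B_n$ and $\mathcal Z_n^I$ its image in $\mathcal Z_n$. The group $\mathcal{PZ}_n$ is an elementary abelian $2$-group with basis the images of the Artin generators $T_{ij}$ ($i<j$); let $V_I$ be the one-dimensional representation of $\mathcal{PZ}_n$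 on which $T_{ij}$ acts by $-1$ if $\{i,j\}\in I$ and by $1$ otherwise. A representation of a subgroup of $\mathcal Z_n$ containing $\mathcal{PZ}_n$ is *$I$-isotypic* if its restriction to $\mathcal{PZ}_n$ is a direct sum of copies of $V_I$. Let $m\le n$ and $I\in\mathbb I_m$, and regard $I$ also as a subset of $[n]^{\underline 2}$. Forgetting the last $n-m$ strands, and forgetting the first $m$ strands and passing to the underlying permutation, induce a homomorphism $\mathcal Z_n^I\to\mathcal Z_m^I\times S_{n-m}$. For an irreducible $I$-isotypic representation $V_m(\rho)$ of $\mathcal Z_m^I$ and an irreducible representation $V_{n-m}(\lambda)$ of $S_{n-m}$, let $$V_n(\rho,\lambda)=\mathrm{Ind}_{\mathcal Z_n^I}^{\mathcal Z_n}\bigl(V_m(\rho)\boxtimes V_{n-m}(\lambda)\bigr),$$ where $\mathcal Z_n^I$ acts through the above homomorphism. Fix one representative $\rho$ of each isomorphism class of irreducible $I$-isotypic representations of $\mathcal Z_m^I$ (for all $m$ and $I\in\mathbb I_m$), and one representative $\lambda$ of each isomorphism class of irreducible representations of $S_k$ (for all $k$). **Theorem 1.4.** For every $n\ge 0$, every $V_n(\rho,\lambda)$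 is an irreducible representation of $\mathcal Z_n$, and every irreducible representation of $\mathcal Z_n$ is isomorphic to $V_n(\rho,\lambda)$ for exactly one choice of $m\le n$, $I\in\mathbb I_m$, $\rho$ and $\lambda$. -/

import Mathlib

open scoped Pointwise Matrix

universe u

namespace BraidRep

noncomputable section

/-- Relators of the Artin presentation; the generator `i : Fin (n - 1)` exchanges the positions
`i` and `i + 1` of `{0, …, n - 1}`. -/
def braidRels (n : ℕ) : Set (FreeGroup (Fin (n - 1))) :=
  {r | ∃ i j : Fin (n - 1), (i : ℕ) + 1 = j ∧
      r = FreeGroup.of i * FreeGroup.of j * FreeGroup.of i *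
        (FreeGroup.of j * FreeGroup.of i * FreeGroup.of j)⁻¹} ∪
  {r | ∃ i j : Fin (n - 1), (i : ℕ) + 2 ≤ j ∧
      r = FreeGroup.of i * FreeGroup.of j * (FreeGroup.of j * FreeGroup.of i)⁻¹}

/-- The braid group on `n` strands. -/
abbrev Braid (n : ℕ) : Type := PresentedGroup (braidRels n)

/-- The half-twist `σ_i`, for `i + 1 < n`; by convention it is `1` for other `i`. -/
def σ (n i : ℕ) : Braid n := if h : i < n - 1 then PresentedGroup.of ⟨i, h⟩ else 1

theorem σ_fin {n : ℕ} (i : Fin (n - 1)) : σ n i = PresentedGroup.of i := by simp [σ]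

theorem σ_braid {n i : ℕ} (h : i + 2 < n) :
    σ n i * σ n (i + 1) * σ n i = σ n (i + 1) * σ n i * σ n (i + 1) := by
  have h1 : i < n - 1 := by omega
  have h2 : i + 1 < n - 1 := by omega
  have := PresentedGroup.one_of_mem (rels := braidRels n)
    (Or.inl ⟨⟨i, h1⟩, ⟨i + 1, h2⟩, rfl, rfl⟩)
  simp only [map_mul, map_inv, mul_inv_eq_one] at this
  simpa [σ, h1, h2, PresentedGroup.of] using this

theorem σ_comm {n i j : ℕ} (h : i + 2 ≤ j) : σ n i * σ n j = σ n j * σ n i := by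
  by_cases h2 : j < n - 1
  · have h1 : i < n - 1 := by omega
    have := PresentedGroup.one_of_mem (rels := braidRels n)
      (Or.inr ⟨⟨i, h1⟩, ⟨j, h2⟩, h, rfl⟩)
    simp only [map_mul, map_inv, mul_inv_eq_one] at this
    simpa [σ, h1, h2, PresentedGroup.of] using this
  · simp [σ, h2]

/-- Homomorphisms out of the braid group. -/
def Braid.lift {n : ℕ} {G : Type*} [Group G] (f : Fin (n - 1) → G)
    (h1 : ∀ i j : Fin (n - 1), (i : ℕ) + 1 = j → f i * f j * f i = f j * f i * f j)
    (h2 : ∀ i j : Fin (n - 1), (i : ℕ) + 2 ≤ j → f i * f j = f j * f i) : Braid n →* G :=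
  PresentedGroup.toGroup (f := f) (by
    rintro r (⟨i, j, hij, rfl⟩ | ⟨i, j, hij, rfl⟩)
    · rw [map_mul, map_inv, mul_inv_eq_one]
      simpa using h1 i j hij
    · rw [map_mul, map_inv, mul_inv_eq_one]
      simpa using h2 i j hij)

theorem Braid.lift_of {n : ℕ} {G : Type*} [Group G] (f : Fin (n - 1) → G) (h1 h2)
    (i : Fin (n - 1)) : Braid.lift f h1 h2 (PresentedGroup.of i) = f i := PresentedGroup.toGroup.of _

/-- The left one of the two positions exchanged by the `i`th half-twist. -/
def lo {n : ℕ} (i : Fin (n - 1)) : Fin n := ⟨i, by omega⟩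
/-- The right one of the two positions exchanged by the `i`th half-twist. -/
def hi {n : ℕ} (i : Fin (n - 1)) : Fin n := ⟨i + 1, by omega⟩

theorem lo_ne_hi {n : ℕ} (i : Fin (n - 1)) : lo i ≠ hi i := by simp [lo, hi, Fin.ext_iff]

/-- The usual homomorphism `B_n → S_n`. -/
def perm (n : ℕ) : Braid n →* Equiv.Perm (Fin n) :=
  Braid.lift (fun i => Equiv.swap (lo i) (hi i))
    (by
      intro i j hij
      have e : lo j = hi i := by simp [lo, hi, ← hij]
      have n1 : lo i ≠ hi i := lo_ne_hi i
      have n2 : hi i ≠ hi j := by simp [hi, Fin.ext_iff]; omega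
      have n3 : lo i ≠ hi j := by simp [lo, hi, Fin.ext_iff]; omega
      rw [e, Equiv.swap_mul_swap_mul_swap n1 n3]
      rw [Equiv.swap_comm (lo i), Equiv.swap_comm (hi i) (hi j),
        Equiv.swap_mul_swap_mul_swap n2.symm n3.symm, Equiv.swap_comm])
    (by
      intro i j hij
      ext x
      simp only [Equiv.Perm.mul_apply, Equiv.swap_apply_def, lo, hi]
      grind)

open LaurentPolynomial in
/-- The (unreduced) Burau matrix of a half-twist: the identity except for the block
`(1 - t, t; 1, 0)` in rows and columns `i`, `i + 1`. -/
def burauMatrix {n : ℕ} (i : Fin (n - 1)) : Matrix (Fin n) (Fin n) (LaurentPolynomial ℤ) :=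
  1 - Matrix.single (lo i) (lo i) (T 1) + Matrix.single (lo i) (hi i) (T 1)
    + Matrix.single (hi i) (lo i) 1 - Matrix.single (hi i) (hi i) 1

open LaurentPolynomial in
/-- The inverse of the Burau matrix of a half-twist. -/
def burauMatrixInv {n : ℕ} (i : Fin (n - 1)) : Matrix (Fin n) (Fin n) (LaurentPolynomial ℤ) :=
  1 - Matrix.single (lo i) (lo i) 1 + Matrix.single (lo i) (hi i) 1
    + Matrix.single (hi i) (lo i) (T (-1)) - Matrix.single (hi i) (hi i) (T (-1))

open LaurentPolynomial in
theorem T_mul_T_neg : (T 1 * T (-1) : LaurentPolynomial ℤ) = 1 := by rw [← T_add]; simp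

open LaurentPolynomial in
/-- The Burau matrix of a half-twist as an invertible matrix. -/
def burauUnit {n : ℕ} (i : Fin (n - 1)) : GL (Fin n) (LaurentPolynomial ℤ) where
  val := burauMatrix i
  inv := burauMatrixInv i
  val_inv := by
    have h := lo_ne_hi i
    simp only [burauMatrix, burauMatrixInv, mul_add, add_mul, mul_sub, sub_mul, one_mul, mul_one,
      Matrix.single_mul_single_same, Matrix.single_mul_single_of_ne _ _ _ _ h,
      Matrix.single_mul_single_of_ne _ _ _ _ h.symm, T_mul_T_neg]
    abel
  inv_val := by
    have h := lo_ne_hi i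
    simp only [burauMatrix, burauMatrixInv, mul_add, add_mul, mul_sub, sub_mul, one_mul, mul_one,
      Matrix.single_mul_single_same, Matrix.single_mul_single_of_ne _ _ _ _ h,
      Matrix.single_mul_single_of_ne _ _ _ _ h.symm, mul_comm (T (-1)), T_mul_T_neg]
    abel

open LaurentPolynomial in
/-- The Burau representation. -/
def burau (n : ℕ) : Braid n →* GL (Fin n) (LaurentPolynomial ℤ) :=
  Braid.lift burauUnit
    (by
      intro i j hij
      apply Units.ext
      have e : lo j = hi i := by simp [lo, hi, ← hij]
      have n1 : lo i ≠ hi i := lo_ne_hi i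
      have n2 : hi i ≠ hi j := by simp [hi, Fin.ext_iff]; omega
      have n3 : lo i ≠ hi j := by simp [lo, hi, Fin.ext_iff]; omega
      simp only [burauUnit, Units.val_mul, burauMatrix, e]
      simp only [mul_add, add_mul, mul_sub, sub_mul, one_mul, mul_one,
        Matrix.single_mul_single_same, Matrix.single_mul_single_of_ne _ _ _ _ n1,
        Matrix.single_mul_single_of_ne _ _ _ _ n1.symm,
        Matrix.single_mul_single_of_ne _ _ _ _ n2,
        Matrix.single_mul_single_of_ne _ _ _ _ n2.symm,
        Matrix.single_mul_single_of_ne _ _ _ _ n3,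
        Matrix.single_mul_single_of_ne _ _ _ _ n3.symm, zero_mul]
      abel)
    (by
      intro i j hij
      apply Units.ext
      have n1 : lo i ≠ lo j := by simp [lo, Fin.ext_iff]; omega
      have n2 : lo i ≠ hi j := by simp [lo, hi, Fin.ext_iff]; omega
      have n3 : hi i ≠ lo j := by simp [lo, hi, Fin.ext_iff]; omega
      have n4 : hi i ≠ hi j := by simp [hi, Fin.ext_iff]; omega
      simp only [burauUnit, Units.val_mul, burauMatrix]
      simp only [mul_add, add_mul, mul_sub, sub_mul, one_mul, mul_one,
        Matrix.single_mul_single_of_ne _ _ _ _ n1,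
        Matrix.single_mul_single_of_ne _ _ _ _ n1.symm,
        Matrix.single_mul_single_of_ne _ _ _ _ n2,
        Matrix.single_mul_single_of_ne _ _ _ _ n2.symm,
        Matrix.single_mul_single_of_ne _ _ _ _ n3,
        Matrix.single_mul_single_of_ne _ _ _ _ n3.symm,
        Matrix.single_mul_single_of_ne _ _ _ _ n4,
        Matrix.single_mul_single_of_ne _ _ _ _ n4.symm]
      abel)

/-- Evaluation of Laurent polynomials at `t = -1`. -/
def evalNegOne : LaurentPolynomial ℤ →+* ℤ := LaurentPolynomial.eval₂ (RingHom.id ℤ) (-1)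

/-- The Burau representation at `t = -1`, with entries reduced modulo `k`. -/
def burauMod (n k : ℕ) : Braid n →* GL (Fin n) (ZMod k) :=
  (Matrix.GeneralLinearGroup.map (Int.castRingHom (ZMod k))).comp
    ((Matrix.GeneralLinearGroup.map evalNegOne).comp (burau n))

/-- The level `k` braid group `B_n[k]`: the kernel of the Burau representation at `t = -1`
modulo `k`. -/
def level (n k : ℕ) : Subgroup (Braid n) := (burauMod n k).ker

instance (n k : ℕ) : (level n k).Normal := by unfold level; infer_instance

/-- `Z n = B_n / B_n[4]`. -/
abbrev Z (n : ℕ) : Type := Braid n ⧸ level n 4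

theorem burauMod_of (n k : ℕ) (i : Fin (n - 1)) :
    (burauMod n k (PresentedGroup.of i) : Matrix (Fin n) (Fin n) (ZMod k)) =
    1 + Matrix.single (lo i) (lo i) 1 - Matrix.single (lo i) (hi i) 1
    + Matrix.single (hi i) (lo i) 1 - Matrix.single (hi i) (hi i) 1 := by
  have hT : evalNegOne (LaurentPolynomial.T 1) = -1 := by
    simp [evalNegOne, LaurentPolynomial.eval₂_T]
  have : burau n (PresentedGroup.of i) = burauUnit i := Braid.lift_of _ _ _ i
  ext a b
  simp only [burauMod, MonoidHom.comp_apply, this, Matrix.GeneralLinearGroup.map_apply]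
  simp only [burauUnit, burauMatrix, Matrix.sub_apply, Matrix.add_apply, Matrix.one_apply,
    Matrix.single_apply, map_sub, map_add, apply_ite evalNegOne, hT, map_one, map_zero]
  split_ifs <;> simp

theorem perm_of (n : ℕ) (i : Fin (n - 1)) :
    perm n (PresentedGroup.of i) = Equiv.swap (lo i) (hi i) := Braid.lift_of _ _ _ i

/-- The sets of `k` elements of `{0, …, n - 1}`, with the action of the symmetric group. -/
abbrev Sub (n k : ℕ) : Type := Set.powersetCard (Fin n) k

/-- The number of elements of `A` that lie to the left of `x`. -/
def rank {n m : ℕ} (A : Sub n m) (x : Fin n) : ℕ := (A.1.filter (· < x)).card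

theorem mem_smul_iff {n m : ℕ} (g : Equiv.Perm (Fin n)) (A : Sub n m) (x : Fin n) :
    x ∈ (g • A : Sub n m).1 ↔ g⁻¹ x ∈ A.1 := by
  rw [Set.powersetCard.coe_smul, ← Finset.inv_smul_mem_iff, Equiv.Perm.smul_def]

theorem rank_succ {n m : ℕ} (A : Sub n m) (x y : Fin n) (h : (y : ℕ) = x + 1) :
    rank A y = rank A x + if x ∈ A.1 then 1 else 0 := by
  have : A.1.filter (· < y) = A.1.filter (· < x) ∪ A.1.filter (· = x) := by
    ext z; simp only [Finset.mem_filter, Finset.mem_union]; grind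
  unfold rank
  rw [this, Finset.card_union_of_disjoint]
  · congr 1
    rw [Finset.filter_eq']
    split_ifs <;> simp
  · rw [Finset.disjoint_filter]; grind

theorem rank_mono {n m : ℕ} (A : Sub n m) {x y : Fin n} (h : x ≤ y) : rank A x ≤ rank A y :=
  Finset.card_le_card (Finset.monotone_filter_right _ (by intro z _ hz; exact lt_of_lt_of_le hz h))

theorem rank_lt {n m : ℕ} (A : Sub n m) {x : Fin n} (h : x ∈ A.1) : rank A x < m := by
  refine lt_of_lt_of_eq (Finset.card_lt_card ?_) A.2
  rw [Finset.ssubset_iff_of_subset (Finset.filter_subset _ _)]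
  exact ⟨x, h, by simp⟩

theorem rank_smul {n m : ℕ} (g : Equiv.Perm (Fin n)) (A : Sub n m) (x : Fin n)
    (h : ∀ y, g y < x ↔ y < x) : rank (g • A) x = rank A x := by
  unfold rank
  have : (g • A : Sub n m).1.filter (· < x) = g • (A.1.filter (· < x)) := by
    ext y
    rw [← Finset.inv_smul_mem_iff, Equiv.Perm.smul_def, Finset.mem_filter, Finset.mem_filter,
      Set.powersetCard.coe_smul, ← Finset.inv_smul_mem_iff, Equiv.Perm.smul_def,
      ← h (g⁻¹ y)]
    simp
  rw [this, Finset.card_smul_finset]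

/-- The braid that remains of the half-twist `σ_i` when only the strands ending at the positions
in `A` are kept: a half-twist if both of its strands are kept, and trivial otherwise. -/
def forgetGen {n : ℕ} (m : ℕ) (i : Fin (n - 1)) (A : Sub n m) : Braid m :=
  if lo i ∈ A.1 ∧ hi i ∈ A.1 then σ m (rank A (lo i)) else 1

/-- Families of `m`-strand braids indexed by the `m`-element sets of positions, with the
permutations of the positions adjoined. -/
abbrev ForgetTarget (n m : ℕ) : Type :=
  (Sub n m → Braid m) ⋊[mulAutArrow] Equiv.Perm (Fin n)

theorem ForgetTarget.mul_left {n m : ℕ} (x y : ForgetTarget n m) (A : Sub n m) :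
    (x * y).left A = x.left A * y.left (x.right⁻¹ • A) := rfl

/-- Forgetting all but `m` strands, for all choices of `m` strands at once. -/
def forgetHom (n m : ℕ) : Braid n →* ForgetTarget n m :=
  Braid.lift (fun i => ⟨forgetGen m i, Equiv.swap (lo i) (hi i)⟩)
    (by
      intro i j hij
      have e : lo j = hi i := by simp [lo, hi, ← hij]
      have n1 : lo i ≠ hi i := lo_ne_hi i
      have n2 : hi i ≠ hi j := by simp [hi, Fin.ext_iff]; omega
      have n3 : lo i ≠ hi j := by simp [lo, hi, Fin.ext_iff]; omega
      have hp := congrArg (perm n) (σ_braid (n := n) (i := i) (by omega))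
      rw [hij, σ_fin, σ_fin] at hp
      simp only [map_mul, perm_of] at hp
      refine SemidirectProduct.ext (funext fun A => ?_) hp
      have r1 : rank (Equiv.swap (lo i) (hi i) • A) (hi i) = rank A (lo i) +
          if hi i ∈ A.1 then 1 else 0 := by
        rw [rank_succ _ (lo i) (hi i) rfl, rank_smul]
        · simp only [mem_smul_iff, Equiv.swap_inv, Equiv.swap_apply_left]
        · intro y; simp only [Equiv.swap_apply_def, lo, hi]; grind
      have r2 : rank (Equiv.swap (hi i) (hi j) • A) (lo i) = rank A (lo i) := by
        rw [rank_smul]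
        intro y; simp only [Equiv.swap_apply_def, lo, hi]; grind
      have r3 : rank A (hi i) = rank A (lo i) + if lo i ∈ A.1 then 1 else 0 :=
        rank_succ _ _ _ rfl
      have r4 : rank (Equiv.swap (hi i) (hi j) • Equiv.swap (lo i) (hi i) • A) (lo i) =
          rank A (lo i) := by
        rw [rank_smul, rank_smul]
        · intro y; simp only [Equiv.swap_apply_def, lo, hi]; grind
        · intro y; simp only [Equiv.swap_apply_def, lo, hi]; grind
      have r5 : rank (Equiv.swap (lo i) (hi i) • Equiv.swap (hi i) (hi j) • A) (hi i) =
          rank A (lo i) + if hi j ∈ A.1 then 1 else 0 := by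
        rw [rank_succ _ (lo i) (hi i) rfl, rank_smul, r2]
        · simp only [mem_smul_iff, Equiv.swap_inv, Equiv.swap_apply_left]
        · intro y; simp only [Equiv.swap_apply_def, lo, hi]; grind
      have r6 : lo i ∈ A.1 → hi i ∈ A.1 → hi j ∈ A.1 → rank A (lo i) + 2 < m := by
        intro h h' h''
        have h2 := rank_succ A (hi i) (hi j) (by simp [hi, ← hij])
        have h3 := rank_lt A h''
        simp only [h, h', if_true] at *
        omega
      simp only [ForgetTarget.mul_left, SemidirectProduct.mul_right, forgetGen,
        mul_inv_rev, Equiv.swap_inv, e, mul_smul, r1, r2, r3, r4, r5, mem_smul_iff,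
        Equiv.swap_apply_left, Equiv.swap_apply_right, Equiv.swap_apply_of_ne_of_ne n1 n3,
        Equiv.swap_apply_of_ne_of_ne n3.symm n2.symm]
      by_cases ha : lo i ∈ A.1 <;> by_cases hb : hi i ∈ A.1 <;> by_cases hc : hi j ∈ A.1 <;>
        simp only [ha, hb, hc, and_self, and_true, and_false, if_true,
          if_false, add_zero, mul_one, one_mul]
      exact σ_braid (r6 ha hb hc))
    (by
      intro i j hij
      have n1 : lo i ≠ lo j := by simp [lo, Fin.ext_iff]; omega
      have n2 : lo i ≠ hi j := by simp [lo, hi, Fin.ext_iff]; omega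
      have n3 : hi i ≠ lo j := by simp [lo, hi, Fin.ext_iff]; omega
      have n4 : hi i ≠ hi j := by simp [hi, Fin.ext_iff]; omega
      have hp := congrArg (perm n) (σ_comm (n := n) hij)
      rw [σ_fin, σ_fin] at hp
      simp only [map_mul, perm_of] at hp
      refine SemidirectProduct.ext (funext fun A => ?_) hp
      have r1 : rank (Equiv.swap (lo i) (hi i) • A) (lo j) = rank A (lo j) := by
        rw [rank_smul]
        intro y; simp only [Equiv.swap_apply_def, lo, hi]; grind
      have r2 : rank (Equiv.swap (lo j) (hi j) • A) (lo i) = rank A (lo i) := by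
        rw [rank_smul]
        intro y; simp only [Equiv.swap_apply_def, lo, hi]; grind
      have r3 : lo i ∈ A.1 → hi i ∈ A.1 → rank A (lo i) + 2 ≤ rank A (lo j) := by
        intro h h'
        have : rank A (hi i) = _ := rank_succ _ (lo i) _ rfl
        have h2 := rank_succ A (hi i) ⟨i + 2, by omega⟩ rfl
        have h3 := rank_mono A (x := ⟨i + 2, by omega⟩) (y := lo j) hij
        simp only [h, h', if_true] at *
        omega
      simp only [ForgetTarget.mul_left, forgetGen, mem_smul_iff, Equiv.swap_inv, r1, r2,
        Equiv.swap_apply_of_ne_of_ne n1 n2, Equiv.swap_apply_of_ne_of_ne n3 n4,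
        Equiv.swap_apply_of_ne_of_ne n1.symm n3.symm, Equiv.swap_apply_of_ne_of_ne n2.symm n4.symm]
      by_cases h : lo i ∈ A.1 ∧ hi i ∈ A.1
      · by_cases h' : lo j ∈ A.1 ∧ hi j ∈ A.1
        · simp only [h, h', and_self, if_true]
          exact σ_comm (r3 h.1 h.2)
        · simp [h']
      · simp [h])
theorem Braid.induction {n : ℕ} (p : Braid n → Prop) (h1 : p 1)
    (hg : ∀ i, p (PresentedGroup.of i)) (hm : ∀ x y, p x → p y → p (x * y))
    (hi : ∀ x, p x → p x⁻¹) (x : Braid n) : p x :=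
  PresentedGroup.generated_by (braidRels n)
    { carrier := {x | p x}, mul_mem' := fun {a b} => hm a b, one_mem' := h1,
      inv_mem' := fun {a} => hi a } hg x

/-- The mod 4 Burau matrix at `t = -1`. -/
def M (n : ℕ) (β : Braid n) : Matrix (Fin n) (Fin n) (ZMod 4) := (burauMod n 4 β).1

theorem M_mul {n : ℕ} (β γ : Braid n) : M n (β * γ) = M n β * M n γ := by simp [M]

theorem M_one {n : ℕ} : M n 1 = 1 := by simp [M]

theorem M_of {n : ℕ} (i : Fin (n - 1)) (a b : Fin n) : M n (PresentedGroup.of i) a b =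
    if a = lo i then (if b = lo i then 2 else if b = hi i then -1 else 0)
    else if a = hi i then (if b = lo i then 1 else 0) else if a = b then 1 else 0 := by
  have h := lo_ne_hi i
  unfold M
  rw [burauMod_of]
  simp only [Matrix.sub_apply, Matrix.add_apply, Matrix.one_apply, Matrix.single_apply]
  by_cases h1 : a = lo i
  · subst h1
    by_cases h2 : b = lo i
    · subst h2; simp [h.symm]; decide
    · by_cases h3 : b = hi i
      · subst h3; simp [h, h.symm]
      · simp [Ne.symm h2, Ne.symm h3, h2, h3, h.symm]
  · by_cases h1' : a = hi i
    · subst h1'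
      by_cases h2 : b = lo i
      · subst h2; simp [h, h.symm]
      · by_cases h3 : b = hi i
        · subst h3; simp [h, h.symm]
        · simp [Ne.symm h2, Ne.symm h3, h2, h, h.symm]
    · simp [h1, h1', Ne.symm h1, Ne.symm h1']

theorem M_two {n : ℕ} (β : Braid n) :
    (2 : ZMod 4) • M n β = (2 : ZMod 4) • ((perm n β)⁻¹).permMatrix (ZMod 4) := by
  refine Braid.induction (fun β => (2 : ZMod 4) • M n β =
    (2 : ZMod 4) • ((perm n β)⁻¹).permMatrix (ZMod 4)) ?_ ?_ ?_ ?_ β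
  · simp [M_one]
  · intro i
    have h := lo_ne_hi i
    ext a b
    simp only [Matrix.smul_apply, M_of, perm_of, Equiv.swap_inv, Equiv.Perm.permMatrix,
      PEquiv.toMatrix_apply, Equiv.toPEquiv_apply, Option.mem_def, Option.some.injEq,
      Equiv.swap_apply_def, smul_eq_mul]
    by_cases h1 : a = lo i <;> by_cases h2 : a = hi i <;> by_cases h3 : b = lo i <;>
      by_cases h4 : b = hi i <;> simp_all [eq_comm] <;> decide
  · intro x y hx hy
    rw [M_mul, ← Matrix.smul_mul, hx, Matrix.smul_mul, ← Matrix.mul_smul, hy, Matrix.mul_smul,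
      ← Matrix.permMatrix_mul, map_mul, mul_inv_rev]
  · intro x hx
    have e : ((perm n x)⁻¹).permMatrix (ZMod 4) * ((perm n x⁻¹)⁻¹).permMatrix (ZMod 4) = 1 := by
      rw [← Matrix.permMatrix_mul]; simp
    calc (2 : ZMod 4) • M n x⁻¹
        = M n x⁻¹ * ((2 : ZMod 4) • ((perm n x)⁻¹).permMatrix (ZMod 4)) *
          ((perm n x⁻¹)⁻¹).permMatrix (ZMod 4) := by
          rw [Matrix.mul_smul, Matrix.smul_mul, mul_assoc, e, mul_one]
      _ = _ := by rw [← hx, Matrix.mul_smul, ← M_mul]; simp [M_one]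

theorem M_two_apply {n : ℕ} (β : Braid n) (a b : Fin n) :
    2 * M n β a b = if (perm n β)⁻¹ a = b then 2 else 0 := by
  have := congrFun (congrFun (M_two β) a) b
  simpa [Equiv.Perm.permMatrix, PEquiv.toMatrix_apply] using this

theorem M_row {n : ℕ} (β : Braid n) (a : Fin n) : ∑ b, M n β a b = 1 := by
  have : M n β *ᵥ (fun _ => 1) = fun _ => 1 := by
    refine Braid.induction (fun β => M n β *ᵥ (fun _ => 1) = fun _ => 1) ?_ ?_ ?_ ?_ β
    · simp [M_one]
    · intro i
      ext a
      rw [M, burauMod_of]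
      simp [Matrix.sub_mulVec, Matrix.add_mulVec, Matrix.single_mulVec]
    · intro x y hx hy
      rw [M_mul, ← Matrix.mulVec_mulVec, hy, hx]
    · intro x hx
      conv_lhs => rw [← hx]
      rw [Matrix.mulVec_mulVec, ← M_mul]; simp [M_one]
  have := congrFun this a
  simpa [Matrix.mulVec, dotProduct] using this

/-- The deviation of the mod 4 Burau matrix from the permutation matrix. -/
def dev {n : ℕ} (β : Braid n) (a b : Fin n) : ZMod 4 :=
  M n β a ((perm n β)⁻¹ b) - if a = b then 1 else 0

theorem dev_mul {n : ℕ} (β γ : Braid n) (a b : Fin n) :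
    dev (β * γ) a b = dev β a b + dev γ ((perm n β)⁻¹ a) ((perm n β)⁻¹ b) := by
  set p := (perm n β)⁻¹ a with hp
  set q := (perm n β)⁻¹ b with hq
  have key : ∀ x y : ZMod 4, 2 * x = 0 → 2 * y = 0 → x * y = 0 := by decide
  have hE : ∀ l, 2 * (M n β a l - if p = l then 1 else 0) = 0 := by
    intro l; rw [mul_sub, M_two_apply]; split_ifs <;> simp_all
  have hF : ∀ l, 2 * (M n γ l ((perm n γ)⁻¹ q) - if l = q then 1 else 0) = 0 := by
    intro l; rw [mul_sub, M_two_apply]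
    simp only [EmbeddingLike.apply_eq_iff_eq]
    split_ifs <;> simp
  have h0 : ∑ l, (M n β a l - if p = l then 1 else 0) *
      (M n γ l ((perm n γ)⁻¹ q) - if l = q then 1 else 0) = 0 :=
    Finset.sum_eq_zero fun l _ => key _ _ (hE l) (hF l)
  simp only [mul_sub, sub_mul, Finset.sum_sub_distrib, ite_mul, mul_ite, mul_one, mul_zero,
    one_mul, zero_mul, Finset.sum_ite_eq, Finset.sum_ite_eq', Finset.mem_univ, if_true] at h0
  have hab : (a = b) = (p = q) := by simp [hp, hq]
  simp only [dev, M_mul, Matrix.mul_apply, map_mul, mul_inv_rev, Equiv.Perm.mul_apply, ← hq, hab]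
  linear_combination h0

theorem dev_one {n : ℕ} (a b : Fin n) : dev (1 : Braid n) a b = 0 := by
  simp [dev, M_one, Matrix.one_apply]

theorem dev_inv {n : ℕ} (β : Braid n) (a b : Fin n) :
    dev β⁻¹ a b = - dev β (perm n β a) (perm n β b) := by
  have := dev_mul β β⁻¹ (perm n β a) (perm n β b)
  rw [mul_inv_cancel, dev_one, ← Equiv.Perm.mul_apply, ← Equiv.Perm.mul_apply, inv_mul_cancel] at this
  simp only [Equiv.Perm.coe_one, id_eq] at this
  linear_combination -this

theorem dev_of {n : ℕ} (i : Fin (n - 1)) (a b : Fin n) (hab : a ≠ b) :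
    dev (PresentedGroup.of i : Braid n) a b = if a = lo i ∧ b = hi i then 2 else 0 := by
  have h := lo_ne_hi i
  simp only [dev, M_of, perm_of, Equiv.swap_inv, Equiv.swap_apply_def]
  by_cases h1 : a = lo i <;> by_cases h2 : a = hi i <;> by_cases h3 : b = lo i <;>
      by_cases h4 : b = hi i <;> simp_all [eq_comm]

theorem dev_row {n : ℕ} (β : Braid n) (a : Fin n) : ∑ b, dev β a b = 0 := by
  simp only [dev, Finset.sum_sub_distrib, Finset.sum_ite_eq, Finset.mem_univ, if_true]
  rw [Equiv.sum_comp ((perm n β)⁻¹) (fun b => M n β a b), M_row, sub_self]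

theorem mem_level_iff {n : ℕ} (β : Braid n) :
    β ∈ level n 4 ↔ perm n β = 1 ∧ ∀ a b, a ≠ b → dev β a b = 0 := by
  have hl : β ∈ level n 4 ↔ M n β = 1 := by
    rw [level, MonoidHom.mem_ker, Units.ext_iff]; rfl
  rw [hl]
  constructor
  · intro h
    have hp : perm n β = 1 := by
      rw [← inv_eq_one]
      ext1 a
      by_contra hne'
      have hne : (perm n β)⁻¹ a ≠ a := hne'
      have := M_two_apply β a ((perm n β)⁻¹ a)
      rw [h, Matrix.one_apply_ne (Ne.symm hne)] at this
      simp at this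
      revert this; decide
    refine ⟨hp, fun a b hab => ?_⟩
    simp [dev, hp, h, hab]
  · rintro ⟨hp, hd⟩
    have hd' : ∀ a b, dev β a b = 0 := by
      intro a b
      by_cases hab : a = b
      · subst hab
        rw [← dev_row β a, Finset.sum_eq_single a (fun b _ hb => hd a b hb.symm) (by simp)]
      · exact hd a b hab
    ext a b
    have := hd' a b
    simp only [dev, hp, inv_one, Equiv.Perm.coe_one, id_eq, sub_eq_zero] at this
    rw [this, Matrix.one_apply]
/-- The braid obtained from `β` by keeping the `m` strands that end at the positions in `A`. -/
def forget {n m : ℕ} (β : Braid n) (A : Sub n m) : Braid m := (forgetHom n m β).left A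

theorem forgetHom_right {n m : ℕ} (β : Braid n) : (forgetHom n m β).right = perm n β := by
  have : SemidirectProduct.rightHom.comp (forgetHom n m) = perm n := by
    apply PresentedGroup.ext
    intro i
    rw [perm_of, MonoidHom.comp_apply, forgetHom, Braid.lift_of]
    rfl
  exact DFunLike.congr_fun this β

theorem forget_mul {n m : ℕ} (β γ : Braid n) (A : Sub n m) :
    forget (β * γ) A = forget β A * forget γ ((perm n β)⁻¹ • A) := by
  rw [forget, map_mul, ForgetTarget.mul_left, forgetHom_right]; rfl

theorem forget_one {n m : ℕ} (A : Sub n m) : forget (1 : Braid n) A = 1 := by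
  rw [forget, map_one]; rfl

theorem forget_inv {n m : ℕ} (β : Braid n) (A : Sub n m) :
    forget β⁻¹ A = (forget β (perm n β • A))⁻¹ := by
  have := forget_mul β β⁻¹ (perm n β • A)
  rw [mul_inv_cancel, forget_one, inv_smul_smul] at this
  exact (inv_eq_of_mul_eq_one_right this.symm).symm

theorem forget_of {n m : ℕ} (i : Fin (n - 1)) (A : Sub n m) :
    forget (PresentedGroup.of i : Braid n) A = forgetGen m i A := by
  rw [forget, forgetHom, Braid.lift_of]

/-- The increasing enumeration of `A`. -/
def emb {n m : ℕ} (A : Sub n m) : Fin m ↪o Fin n := A.1.orderEmbOfFin A.2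

theorem emb_mem {n m : ℕ} (A : Sub n m) (j : Fin m) : emb A j ∈ A.1 :=
  Finset.orderEmbOfFin_mem _ _ _

theorem exists_emb {n m : ℕ} (A : Sub n m) {x : Fin n} (h : x ∈ A.1) : ∃ j, emb A j = x := by
  have := Finset.range_orderEmbOfFin A.1 A.2
  have hx : x ∈ Set.range (A.1.orderEmbOfFin A.2) := by rw [this]; exact h
  exact hx

theorem rank_emb {n m : ℕ} (A : Sub n m) (j : Fin m) : rank A (emb A j) = j := by
  have : A.1.filter (· < emb A j) = (Finset.Iio j).map (emb A).toEmbedding := by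
    ext x
    simp only [Finset.mem_filter, Finset.mem_map, Finset.mem_Iio]
    constructor
    · rintro ⟨hx, hl⟩
      obtain ⟨k, rfl⟩ := exists_emb A hx
      exact ⟨k, by simpa using hl, rfl⟩
    · rintro ⟨k, hk, rfl⟩
      exact ⟨emb_mem A k, by simpa using hk⟩
  rw [rank, this, Finset.card_map, Fin.card_Iio]

theorem emb_eq_iff {n m : ℕ} (A : Sub n m) {x : Fin n} (h : x ∈ A.1) (j : Fin m) :
    emb A j = x ↔ (j : ℕ) = rank A x := by
  obtain ⟨k, rfl⟩ := exists_emb A h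
  rw [rank_emb, EmbeddingLike.apply_eq_iff_eq, Fin.ext_iff]

theorem emb_unique {n m : ℕ} (A : Sub n m) (f : Fin m → Fin n) (hf : ∀ j, f j ∈ A.1)
    (hm : StrictMono f) (j : Fin m) : emb A j = f j :=
  (congrFun (Finset.orderEmbOfFin_unique A.2 hf hm) j).symm

theorem swap_lt {n : ℕ} {i : Fin (n - 1)} {x y : Fin n} (hlt : x < y)
    (h : ¬ (x = lo i ∧ y = hi i)) : Equiv.swap (lo i) (hi i) x < Equiv.swap (lo i) (hi i) y := by
  simp only [Equiv.swap_apply_def, lo, hi] at *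
  grind

theorem perm_forget {n m : ℕ} (β : Braid n) (A : Sub n m) (k : Fin m) :
    emb A (perm m (forget β A) k) = perm n β (emb ((perm n β)⁻¹ • A) k) := by
  refine Braid.induction (fun β => ∀ (A : Sub n m) k, emb A (perm m (forget β A) k) =
    perm n β (emb ((perm n β)⁻¹ • A) k)) ?_ ?_ ?_ ?_ β A k
  · intro A k; simp [forget_one]
  · intro i A k
    rw [forget_of, perm_of, Equiv.swap_inv, forgetGen]
    split_ifs with h
    · obtain ⟨h1, h2⟩ := h
      have hA : Equiv.swap (lo i) (hi i) • A = A := by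
        apply Subtype.ext
        ext x
        rw [mem_smul_iff, Equiv.swap_inv, Equiv.swap_apply_def]
        split_ifs <;> simp_all
      have hr : rank A (hi i) = rank A (lo i) + 1 := by
        rw [rank_succ A (lo i) (hi i) rfl, if_pos h1]
      have hlt := rank_lt A h2
      have hlt' : rank A (lo i) < m - 1 := by omega
      have e1 := emb_eq_iff A h1
      have e2 := emb_eq_iff A h2
      obtain ⟨c, hc⟩ : ∃ c : Fin (m - 1), (c : ℕ) = rank A (lo i) := ⟨⟨_, hlt'⟩, rfl⟩
      have f1 : emb A (lo c) = lo i := (e1 _).2 hc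
      have f2 : emb A (hi c) = hi i := (e2 _).2 (by rw [hr, ← hc]; rfl)
      rw [hA, ← hc, σ_fin, perm_of, ← f1, ← f2, Equiv.swap_apply_def, Equiv.swap_apply_def]
      simp only [EmbeddingLike.apply_eq_iff_eq]
      split_ifs <;> rfl
    · rw [map_one, Equiv.Perm.one_apply]
      apply emb_unique
      · intro j
        have := emb_mem (Equiv.swap (lo i) (hi i) • A) j
        rwa [mem_smul_iff, Equiv.swap_inv] at this
      · intro a b hab
        have ha := emb_mem (Equiv.swap (lo i) (hi i) • A) a
        have hb := emb_mem (Equiv.swap (lo i) (hi i) • A) b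
        rw [mem_smul_iff, Equiv.swap_inv] at ha hb
        have hlt : emb (Equiv.swap (lo i) (hi i) • A) a < emb (Equiv.swap (lo i) (hi i) • A) b :=
          by simpa using hab
        refine swap_lt hlt fun hxy => ?_
        rw [hxy.1, Equiv.swap_apply_left] at ha
        rw [hxy.2, Equiv.swap_apply_right] at hb
        exact h ⟨hb, ha⟩
  · intro x y hx hy A k
    rw [forget_mul, map_mul, map_mul, Equiv.Perm.mul_apply, Equiv.Perm.mul_apply, hx, hy,
      mul_inv_rev, mul_smul]
  · intro x hx A k
    have := hx (perm n x • A) ((perm m (forget x (perm n x • A)))⁻¹ k)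
    rw [inv_smul_smul, ← Equiv.Perm.mul_apply, mul_inv_cancel, Equiv.Perm.one_apply] at this
    rw [forget_inv, map_inv, map_inv, inv_inv, this, ← Equiv.Perm.mul_apply, inv_mul_cancel,
      Equiv.Perm.one_apply]

theorem emb_perm_inv {n m : ℕ} (β : Braid n) (A : Sub n m) (k : Fin m) :
    (perm n β)⁻¹ (emb A k) = emb ((perm n β)⁻¹ • A) ((perm m (forget β A))⁻¹ k) := by
  rw [Equiv.Perm.inv_eq_iff_eq, ← perm_forget, ← Equiv.Perm.mul_apply, mul_inv_cancel,
    Equiv.Perm.one_apply]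

theorem dev_forget {n m : ℕ} (β : Braid n) (A : Sub n m) (j k : Fin m) (hjk : j ≠ k) :
    dev (forget β A) j k = dev β (emb A j) (emb A k) := by
  refine Braid.induction (fun β => ∀ (A : Sub n m) j k, j ≠ k →
    dev (forget β A) j k = dev β (emb A j) (emb A k)) ?_ ?_ ?_ ?_ β A j k hjk
  · intro A j k _; simp [forget_one, dev_one]
  · intro i A j k hjk
    rw [forget_of, forgetGen, dev_of _ _ _ (by simpa using hjk)]
    split_ifs with h h' h'
    · obtain ⟨h1, h2⟩ := h
      rw [emb_eq_iff A h1, emb_eq_iff A h2, rank_succ A (lo i) (hi i) rfl, if_pos h1] at h'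
      have hlt' : rank A (lo i) < m - 1 := by have := k.2; omega
      rw [show σ m (rank A (lo i)) = PresentedGroup.of ⟨rank A (lo i), hlt'⟩ from
        σ_fin ⟨_, hlt'⟩, dev_of _ _ _ hjk, if_pos]
      simpa [lo, hi, Fin.ext_iff] using h'
    · obtain ⟨h1, h2⟩ := h
      rw [emb_eq_iff A h1, emb_eq_iff A h2, rank_succ A (lo i) (hi i) rfl, if_pos h1] at h'
      have hlt := rank_lt A h2
      rw [rank_succ A (lo i) (hi i) rfl, if_pos h1] at hlt
      have hlt' : rank A (lo i) < m - 1 := by omega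
      rw [show σ m (rank A (lo i)) = PresentedGroup.of ⟨rank A (lo i), hlt'⟩ from
        σ_fin ⟨_, hlt'⟩, dev_of _ _ _ hjk, if_neg]
      simpa [lo, hi, Fin.ext_iff] using h'
    · exact absurd ⟨h'.1 ▸ emb_mem A j, h'.2 ▸ emb_mem A k⟩ h
    · exact dev_one _ _
  · intro x y hx hy A j k hjk
    rw [forget_mul, dev_mul, dev_mul, hx _ _ _ hjk, hy _ _ _ (by simpa using hjk),
      emb_perm_inv, emb_perm_inv]
  · intro x hx A j k hjk
    rw [forget_inv, dev_inv, dev_inv, ← inv_inv (perm n x)]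
    have e : ∀ k, (perm n x⁻¹)⁻¹ (emb A k) = _ := fun k => emb_perm_inv x⁻¹ A k
    simp only [map_inv, inv_inv, forget_inv] at e
    rw [inv_inv, e, e, hx _ _ _ (by simpa using hjk)]

theorem forget_mem_level {n m : ℕ} {β : Braid n} (h : β ∈ level n 4) (A : Sub n m) :
    forget β A ∈ level m 4 := by
  rw [mem_level_iff] at h ⊢
  refine ⟨?_, fun a b hab => ?_⟩
  · ext1 k
    have := perm_forget β A k
    rw [h.1, inv_one, one_smul, Equiv.Perm.one_apply, EmbeddingLike.apply_eq_iff_eq] at this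
    exact this
  · rw [dev_forget _ _ _ _ hab]
    exact h.2 _ _ (by simpa using hab)
/-- A set `I` of pairs is full if the union of its elements is everything. -/
def IsFull {n : ℕ} (I : Set (Sub n 2)) : Prop := ∀ x : Fin n, ∃ p ∈ I, x ∈ p.1

/-- A set of pairs in `{0, …, m - 1}` regarded as a set of pairs in `{0, …, n - 1}`. -/
def extend {m n : ℕ} (h : m ≤ n) (I : Set (Sub m 2)) : Set (Sub n 2) :=
  Set.powersetCard.map 2 (Fin.castLEEmb h) '' I

/-- The stabilizer in the braid group of a set of pairs. -/
def stabB (n : ℕ) (I : Set (Sub n 2)) : Subgroup (Braid n) :=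
  (MulAction.stabilizer (Equiv.Perm (Fin n)) I).comap (perm n)

/-- The image of the stabilizer in `Z n`. -/
def stabZ (n : ℕ) (I : Set (Sub n 2)) : Subgroup (Z n) :=
  (stabB n I).map (QuotientGroup.mk' (level n 4))

/-- The pure braid group. -/
def pureBraid (n : ℕ) : Subgroup (Braid n) := (perm n).ker

/-- The image of the pure braid group in `Z n`. -/
def PZ (n : ℕ) : Subgroup (Z n) := (pureBraid n).map (QuotientGroup.mk' (level n 4))

/-- The Artin generator `T_{i,j}` of the pure braid group, for `j = i + d + 1`, that is
`(σ_{j-1} ⋯ σ_{i+1}) σ_i² (σ_{j-1} ⋯ σ_{i+1})⁻¹`. -/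
def artinTwist (n i : ℕ) : ℕ → Braid n
  | 0 => σ n i ^ 2
  | d + 1 => σ n (i + d + 1) * artinTwist n i d * (σ n (i + d + 1))⁻¹

theorem artinTwist_mem (n i d : ℕ) : artinTwist n i d ∈ pureBraid n := by
  induction d with
  | zero =>
    rw [pureBraid, MonoidHom.mem_ker, artinTwist, σ]
    split_ifs
    · rw [map_pow, perm_of, pow_two, Equiv.swap_mul_self]
    · simp
  | succ d ih =>
    rw [pureBraid, MonoidHom.mem_ker] at *
    simp [artinTwist, ih]

/-- The image of an Artin generator in `PZ n`. -/
def artinZ (n i d : ℕ) : PZ n :=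
  ⟨QuotientGroup.mk' (level n 4) (artinTwist n i d),
    Subgroup.mem_map_of_mem _ (artinTwist_mem n i d)⟩

/-- `χ` is the character of `PZ n` that corresponds to the set `I` of pairs: it takes the value
`-1` on `T_{i,j}` if `{i, j} ∈ I`, and `1` otherwise. -/
def IsPairCharacter {n : ℕ} (I : Set (Sub n 2)) (χ : PZ n →* ℤˣ) : Prop :=
  ∀ (i d : ℕ) (h : i + d + 1 < n) (p : Sub n 2),
    p.1 = {(⟨i, by omega⟩ : Fin n), ⟨i + d + 1, h⟩} →
      (p ∈ I → χ (artinZ n i d) = -1) ∧ (p ∉ I → χ (artinZ n i d) = 1)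

/-- A representation of a subgroup of `Z n` is `I`-isotypic if on `PZ n` it is a sum of copies of
the one-dimensional representation given by the character that corresponds to `I`, that is, if
`PZ n` acts by scalars through this character. -/
def IsIsotypic {n : ℕ} {Γ : Subgroup (Z n)} (I : Set (Sub n 2)) (V : Rep.{u} ℂ Γ) : Prop :=
  ∃ χ : PZ n →* ℤˣ, IsPairCharacter I χ ∧
    ∀ (g : Γ) (hg : (g : Z n) ∈ PZ n) (v : V), V.ρ g v = ((χ ⟨g, hg⟩ : ℤ) : ℂ) • v

/-- The first `m` positions. -/
def firstPos {m n : ℕ} (h : m ≤ n) : Sub n m :=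
  ⟨Finset.univ.filter fun x : Fin n => (x : ℕ) < m, by
    simp [Set.powersetCard.mem_iff, Fin.card_filter_val_lt, h]⟩

/-- The last `n - m` positions. -/
def lastPos {m n : ℕ} (h : m ≤ n) : Sub n (n - m) :=
  ⟨(firstPos h).1ᶜ, by
    rw [Set.powersetCard.mem_iff, Finset.card_compl, (firstPos h).2, Fintype.card_fin]⟩

theorem mem_firstPos {m n : ℕ} (h : m ≤ n) (x : Fin n) : x ∈ (firstPos h).1 ↔ (x : ℕ) < m := by
  simp [firstPos]

theorem mem_firstPos_iff {m n : ℕ} (h : m ≤ n) {I : Set (Sub m 2)} (hI : IsFull I) (x : Fin n) :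
    x ∈ (firstPos h).1 ↔ ∃ p ∈ extend h I, x ∈ p.1 := by
  rw [mem_firstPos]
  constructor
  · intro hx
    obtain ⟨p, hp, hxp⟩ := hI ⟨x, hx⟩
    exact ⟨_, ⟨p, hp, rfl⟩, Finset.mem_map.2 ⟨_, hxp, rfl⟩⟩
  · rintro ⟨_, ⟨p, hp, rfl⟩, hx⟩
    obtain ⟨y, -, rfl⟩ := Finset.mem_map.1 hx
    exact y.2

theorem stab_firstPos {m n : ℕ} (h : m ≤ n) {I : Set (Sub m 2)} (hI : IsFull I)
    {g : Equiv.Perm (Fin n)} (hg : g • extend h I = extend h I) : g • firstPos h = firstPos h := by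
  apply Subtype.ext
  ext x
  rw [mem_smul_iff, mem_firstPos_iff h hI, mem_firstPos_iff h hI]
  constructor
  · rintro ⟨p, hp, hx⟩
    refine ⟨g • p, hg ▸ Set.smul_mem_smul_set hp, ?_⟩
    rwa [mem_smul_iff]
  · rintro ⟨p, hp, hx⟩
    refine ⟨g⁻¹ • p, ?_, ?_⟩
    · rw [← hg] at hp
      exact Set.mem_smul_set_iff_inv_smul_mem.1 hp
    · rw [mem_smul_iff, inv_inv, ← Equiv.Perm.mul_apply, mul_inv_cancel, Equiv.Perm.one_apply]
      exact hx

theorem stab_lastPos {m n : ℕ} (h : m ≤ n) {I : Set (Sub m 2)} (hI : IsFull I)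
    {g : Equiv.Perm (Fin n)} (hg : g • extend h I = extend h I) : g • lastPos h = lastPos h := by
  apply Subtype.ext
  ext x
  have := congrArg (fun A => x ∈ A.1) (stab_firstPos h hI hg)
  simp only [mem_smul_iff, eq_iff_iff] at this
  rw [mem_smul_iff]
  simp only [lastPos, Finset.mem_compl, this]

theorem emb_firstPos {m n : ℕ} (h : m ≤ n) (k : Fin m) : emb (firstPos h) k = Fin.castLE h k :=
  emb_unique _ (fun k => Fin.castLE h k) (fun j => (mem_firstPos h _).2 j.2)
    (fun _ _ hab => hab) k

theorem mem_stabB {n : ℕ} {I : Set (Sub n 2)} {β : Braid n} :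
    β ∈ stabB n I ↔ perm n β • I = I := Iff.rfl

theorem forget_mem_stabB {m n : ℕ} (h : m ≤ n) {I : Set (Sub m 2)} (hI : IsFull I)
    {β : Braid n} (hβ : β ∈ stabB n (extend h I)) : forget β (firstPos h) ∈ stabB m I := by
  have key : ∀ γ ∈ stabB n (extend h I), ∀ p ∈ I, perm m (forget γ (firstPos h)) • p ∈ I := by
    intro γ hγ p hp
    have hA : (perm n γ)⁻¹ • firstPos h = firstPos h :=
      stab_firstPos h hI (mem_stabB.1 (inv_mem hγ) |> fun e => by rwa [map_inv] at e)
    have e : ∀ k, Fin.castLE h (perm m (forget γ (firstPos h)) k) =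
        perm n γ (Fin.castLE h k) := by
      intro k
      have := perm_forget γ (firstPos h) k
      rwa [hA, emb_firstPos, emb_firstPos] at this
    have h1 : perm n γ • Set.powersetCard.map 2 (Fin.castLEEmb h) p ∈ extend h I := by
      have := Set.smul_mem_smul_set (a := perm n γ) (show _ ∈ extend h I from ⟨p, hp, rfl⟩)
      rwa [mem_stabB.1 hγ] at this
    have h2 : perm n γ • Set.powersetCard.map 2 (Fin.castLEEmb h) p =
        Set.powersetCard.map 2 (Fin.castLEEmb h) (perm m (forget γ (firstPos h)) • p) := by
      apply Subtype.ext
      rw [Set.powersetCard.coe_smul, Set.powersetCard.val_map, Set.powersetCard.val_map,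
        Set.powersetCard.coe_smul]
      ext x
      simp only [Finset.mem_smul_finset, Finset.mem_map, Equiv.Perm.smul_def]
      constructor
      · rintro ⟨_, ⟨k, hk, rfl⟩, rfl⟩
        exact ⟨_, ⟨k, hk, rfl⟩, e k⟩
      · rintro ⟨_, ⟨k, hk, rfl⟩, rfl⟩
        exact ⟨_, ⟨k, hk, rfl⟩, (e k).symm⟩
    obtain ⟨q, hq, hqe⟩ := h2 ▸ h1
    have : q = perm m (forget γ (firstPos h)) • p := by
      apply Subtype.ext
      exact Finset.map_injective _ (congrArg Subtype.val hqe)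
    exact this ▸ hq
  have hfin : I.Finite := Set.toFinite I
  rw [mem_stabB]
  apply Set.eq_of_subset_of_ncard_le
  · rintro _ ⟨p, hp, rfl⟩
    exact key β hβ p hp
  · rw [Set.ncard_smul_set]
  · exact hfin

/-- The forgetful map `B_n^I → B_m^I`, forgetting the last `n - m` strands. -/
def forgetLast {m n : ℕ} (h : m ≤ n) {I : Set (Sub m 2)} (hI : IsFull I) :
    stabB n (extend h I) →* stabB m I where
  toFun β := ⟨forget β.1 (firstPos h), forget_mem_stabB h hI β.2⟩
  map_one' := Subtype.ext (forget_one _)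
  map_mul' β γ := Subtype.ext (by
    have := stab_firstPos h hI (mem_stabB.1 (inv_mem β.2))
    rw [map_inv] at this
    simp only [Subgroup.coe_mul, forget_mul, this])

/-- The forgetful map `B_n^I → B_{n-m}`, forgetting the first `m` strands. -/
def forgetFirst {m n : ℕ} (h : m ≤ n) {I : Set (Sub m 2)} (hI : IsFull I) :
    stabB n (extend h I) →* Braid (n - m) where
  toFun β := forget β.1 (lastPos h)
  map_one' := forget_one _
  map_mul' β γ := by
    have := stab_lastPos h hI (mem_stabB.1 (inv_mem β.2))
    rw [map_inv] at this
    simp only [Subgroup.coe_mul, forget_mul, this]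

/-- The surjection of `B_n^I` onto its image in `Z n`. -/
def toStabZ (n : ℕ) (I : Set (Sub n 2)) : stabB n I →* stabZ n I :=
  (QuotientGroup.mk' (level n 4)).subgroupMap (stabB n I)

theorem toStabZ_surjective (n : ℕ) (I : Set (Sub n 2)) : Function.Surjective (toStabZ n I) :=
  MonoidHom.subgroupMap_surjective _ _

theorem mem_ker_toStabZ {n : ℕ} {I : Set (Sub n 2)} (β : stabB n I) :
    β ∈ (toStabZ n I).ker ↔ β.1 ∈ level n 4 := by
  rw [MonoidHom.mem_ker, ← QuotientGroup.eq_one_iff, Subtype.ext_iff]; rfl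

/-- The map `Z_n^I → Z_m^I × S_{n-m}` induced by the two forgetful maps. -/
def proj {m n : ℕ} (h : m ≤ n) {I : Set (Sub m 2)} (hI : IsFull I) :
    stabZ n (extend h I) →* stabZ m I × Equiv.Perm (Fin (n - m)) :=
  (toStabZ n (extend h I)).liftOfSurjective (toStabZ_surjective _ _)
    ⟨((toStabZ m I).comp (forgetLast h hI)).prod ((perm (n - m)).comp (forgetFirst h hI)), by
      intro β hβ
      rw [mem_ker_toStabZ] at hβ
      rw [MonoidHom.mem_ker, MonoidHom.prod_apply, Prod.mk_eq_one]
      exact ⟨(mem_ker_toStabZ _).2 (forget_mem_level hβ _),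
        ((mem_level_iff _).1 (forget_mem_level hβ (lastPos h))).1⟩⟩

theorem proj_toStabZ {m n : ℕ} (h : m ≤ n) {I : Set (Sub m 2)} (hI : IsFull I)
    (β : stabB n (extend h I)) : proj h hI (toStabZ _ _ β) =
      (toStabZ m I (forgetLast h hI β), perm (n - m) (forgetFirst h hI β)) :=
  MonoidHom.liftOfRightInverse_comp_apply _ _ _ _ _

/-- The representation `V_n(ρ, λ)` of `Z n`: it is induced from the representation `ρ ⊠ λ`
of `Z_n^I`, which acts through `Z_m^I × S_{n-m}`. -/
def inducedRep {m n : ℕ} (h : m ≤ n) {I : Set (Sub m 2)} (hI : IsFull I)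
    (ρ : Rep.{u} ℂ (stabZ m I)) (lam : Rep.{u} ℂ (Equiv.Perm (Fin (n - m)))) : Rep.{u} ℂ (Z n) :=
  Rep.ind (stabZ n (extend h I)).subtype (Rep.of
    (Representation.tprod (ρ.ρ.comp ((MonoidHom.fst _ _).comp (proj h hI)))
      (lam.ρ.comp ((MonoidHom.snd _ _).comp (proj h hI)))))

/-- `R` contains exactly one element of each class of the relation `r` on the objects that
satisfy `C`, and nothing else. -/
def IsSystemOfReps {α : Type*} (C : α → Prop) (r : α → α → Prop) (R : Set α) : Prop :=
  (∀ x ∈ R, C x) ∧ ∀ x, C x → ∃! y, y ∈ R ∧ r x y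

/-- Two representations are isomorphic. -/
def RepIso {G : Type} [Group G] (V W : Rep.{u} ℂ G) : Prop := Nonempty (V.ρ.Equiv W.ρ)

/-- The names `(ρ, λ)`: a number `m ≤ n`, a set `I` in the chosen system of full sets of pairs,
a representation `ρ` in the chosen system for `Z_m^I`, and a representation `λ` in the chosen
system for `S_{n-m}`. -/
structure Name (n : ℕ) (𝕀 : ∀ m, Set (Set (Sub m 2)))
    (R : ∀ (m : ℕ) (I : Set (Sub m 2)), Set (Rep.{u} ℂ (stabZ m I)))
    (L : ∀ k : ℕ, Set (Rep.{u} ℂ (Equiv.Perm (Fin k)))) where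
  m : ℕ
  m_le : m ≤ n
  I : Set (Sub m 2)
  I_mem : I ∈ 𝕀 m
  ρ : Rep.{u} ℂ (stabZ m I)
  ρ_mem : ρ ∈ R m I
  lam : Rep.{u} ℂ (Equiv.Perm (Fin (n - m)))
  lam_mem : lam ∈ L (n - m)

end

end BraidRep

/-!
The statement is Clifford theory for the elementary abelian normal subgroup `PZ n` of the finite
group `Z n`.

The deviation `dev β` of the mod 4 Burau matrix from a permutation matrix is additive on pure
braids, takes values in `{0, 2}`, and is symmetric in its two arguments (`dev_symm`), while the Artin
generator `T_{i,j}` has deviation `2` exactly at `{i, j}` (`dev_artinTwist`). So `PZ n` is a vector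
space over `𝔽₂` with the Artin generators as a basis, its characters are the `pairChar I` for sets
`I` of pairs, and a braid `γ` conjugates `pairChar I` to `pairChar (perm γ • I)`
(`pairChar_conj`). In particular the stabilizer of the character of `I` is `stabZ n I` (`mem_stabZ_iff`).

Clifford's theorem (`IsCliffordInduced.isIrreducible`, `IsCliffordInduced.nonempty_equiv`) says that
inducing from `stabZ n I` to `Z n` preserves irreducibility of representations on which `PZ n` acts
through the character of `I`, and that the induced representation determines the orbit of `I` and
the inducing representation. Every set of pairs is a translate of `extend h I` for a full set `I` of
pairs in `{0, …, m - 1}`, where `m` and the orbit of `I` under `S_m` are unique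
(`exists_smul_extend_eq`, `exists_smul_eq_of_smul_extend_eq`).

For such a set the map `proj` onto `stabZ m I × S_{n-m}` is surjective (`proj_surjective`), its
kernel lies in `PZ n`, and the character of `extend h I` is the pullback of that of `I` (`pairChar_proj`).
Hence the representations of `stabZ n (extend h I)` in question come from the product, whose
irreducible representations are the external tensor products of irreducible representations of the
factors: these are irreducible by Burnside's theorem (`IsIrreducible.tprod_comp`), they determine
their factors by Schur's lemma, and every representation receives a nonzero map from one of them
(`exists_tprod_comp_map`). Frobenius reciprocity (`indLift`) turns such a map into an isomorphism
from `V_n(ρ, λ)` onto a given irreducible representation.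
-/

open scoped TensorProduct MonoidAlgebra

/-! ### Irreducible representations and tensor products -/

open scoped TensorProduct

namespace Representation

section Irreducible

variable {k G V : Type*} [Field k] [Group G] [AddCommGroup V] [Module k V]

theorem isIrreducible_iff_submodule (ρ : Representation k G V) :
    ρ.IsIrreducible ↔ Nontrivial V ∧
      ∀ S : Submodule k V, (∀ g, ∀ v ∈ S, ρ g v ∈ S) → S = ⊥ ∨ S = ⊤ := by
  constructor
  · intro h
    refine ⟨?_, fun S hS => ?_⟩
    · by_contra hV
      rw [not_nontrivial_iff_subsingleton] at hV
      exact bot_ne_top (Subrepresentation.toSubmodule_injective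
        (Subsingleton.elim (⊥ : Subrepresentation ρ).toSubmodule
          (⊤ : Subrepresentation ρ).toSubmodule))
    · rcases eq_bot_or_eq_top (⟨S, fun g v hv => hS g v hv⟩ : Subrepresentation ρ) with h | h
      · exact Or.inl (congrArg Subrepresentation.toSubmodule h)
      · exact Or.inr (congrArg Subrepresentation.toSubmodule h)
  · rintro ⟨hV, h⟩
    have : Nontrivial (Subrepresentation ρ) :=
      ⟨⊥, ⊤, fun e => bot_ne_top (congrArg Subrepresentation.toSubmodule e :
        (⊥ : Submodule k V) = ⊤)⟩
    refine ⟨fun S => ?_⟩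
    rcases h S.toSubmodule (fun g v hv => S.apply_mem_toSubmodule g hv) with h | h
    · exact Or.inl (Subrepresentation.toSubmodule_injective h)
    · exact Or.inr (Subrepresentation.toSubmodule_injective h)

theorem IsIrreducible.nontrivial {ρ : Representation k G V} (h : ρ.IsIrreducible) :
    Nontrivial V := ((isIrreducible_iff_submodule ρ).1 h).1

theorem IsIrreducible.eq_top {ρ : Representation k G V} (h : ρ.IsIrreducible)
    {S : Submodule k V} (hS : ∀ g, ∀ v ∈ S, ρ g v ∈ S) {v : V} (hv : v ∈ S) (hv0 : v ≠ 0) :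
    S = ⊤ :=
  (((isIrreducible_iff_submodule ρ).1 h).2 S hS).resolve_left fun e =>
    hv0 ((Submodule.mem_bot k).1 (e ▸ hv))

/-- Over a finite group of invertible order every nonzero representation contains an irreducible
one. -/
theorem exists_irreducible_subrepresentation_le [Finite G] [NeZero (Nat.card G : k)]
    {ρ : Representation k G V} (T : Subrepresentation ρ) (hT : T ≠ ⊥) :
    ∃ S ≤ T, S.toRepresentation.IsIrreducible := by
  have hs : IsSemisimpleModule (MonoidAlgebra k G) ρ.asModule := inferInstance
  have hat : IsAtomic (Subrepresentation ρ) :=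
    Subrepresentation.subrepresentationSubmoduleOrderIso.isAtomic_iff.2 inferInstance
  obtain ⟨S, hS, hST⟩ := (eq_bot_or_exists_atom_le T).resolve_left hT
  refine ⟨S, hST, (isIrreducible_iff_submodule _).2 ⟨?_, fun T hT => ?_⟩⟩
  · rw [Submodule.nontrivial_iff_ne_bot]
    exact fun e => hS.1 (Subrepresentation.toSubmodule_injective e)
  · let T' : Subrepresentation ρ := ⟨T.map S.toSubmodule.subtype, by
      rintro g _ ⟨v, hv, rfl⟩
      exact ⟨_, hT g v hv, rfl⟩⟩
    have hle : T' ≤ S := by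
      rintro _ ⟨v, hv, rfl⟩
      exact v.2
    rcases hS.le_iff.1 hle with h | h
    · left
      have : T.map S.toSubmodule.subtype = ⊥ := congrArg Subrepresentation.toSubmodule h
      exact Submodule.map_injective_of_injective S.toSubmodule.subtype_injective
        (this.trans (Submodule.map_bot _).symm)
    · right
      have : T.map S.toSubmodule.subtype = S.toSubmodule :=
        congrArg Subrepresentation.toSubmodule h
      rw [eq_top_iff]
      rintro ⟨v, hv⟩ -
      rw [← this] at hv
      obtain ⟨w, hw, rfl⟩ := hv
      exact hw

theorem IsIrreducible.finiteDimensional [Finite G] {ρ : Representation k G V}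
    (h : ρ.IsIrreducible) : FiniteDimensional k V := by
  have := h.nontrivial
  obtain ⟨v, hv⟩ := exists_ne (0 : V)
  have hS : Submodule.span k (Set.range fun g => ρ g v) = ⊤ := by
    refine h.eq_top (fun g w hw => ?_) (v := v) (Submodule.subset_span ⟨1, by simp⟩) hv
    induction hw using Submodule.span_induction with
    | mem x hx =>
      obtain ⟨g', rfl⟩ := hx
      exact Submodule.subset_span ⟨g * g', by simp⟩
    | zero => simp
    | add x y _ _ hx hy => rw [map_add]; exact add_mem hx hy
    | smul c x _ hx => rw [map_smul]; exact Submodule.smul_mem _ _ hx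
  exact ⟨hS ▸ Submodule.fg_span (Set.finite_range _)⟩

/-- Burnside's theorem: the operators of an irreducible representation over an algebraically
closed field span the space of all endomorphisms. By Schur's lemma every endomorphism is linear
over the commutant, so this is the density theorem. -/
theorem IsIrreducible.span_range_eq_top [IsAlgClosed k] [FiniteDimensional k V]
    {ρ : Representation k G V} (h : ρ.IsIrreducible) :
    Submodule.span k (Set.range ρ) = (⊤ : Submodule k (V →ₗ[k] V)) := by
  have hs : IsSimpleModule (MonoidAlgebra k G) ρ.asModule :=
    (irreducible_iff_isSimpleModule_asModule ρ).1 h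
  have hschur := IsSimpleModule.algebraMap_end_bijective_of_isAlgClosed k
    (A := MonoidAlgebra k G) (V := ρ.asModule)
  rw [eq_top_iff]
  rintro f -
  let F : Module.End (Module.End (MonoidAlgebra k G) ρ.asModule) ρ.asModule :=
    { toFun := fun v => ρ.asModuleEquiv.symm (f (ρ.asModuleEquiv v))
      map_add' := fun v w => by simp
      map_smul' := fun c v => by
        obtain ⟨c, rfl⟩ := hschur.2 c
        simp }
  obtain ⟨s, hs⟩ := (Module.Finite.fg_top : (⊤ : Submodule k V).FG)
  classical
  obtain ⟨r, hr⟩ := jacobson_density F (s.image ρ.asModuleEquiv.symm)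
  have hf : f = ρ.asAlgebraHom r := by
    refine LinearMap.ext_on hs fun v hv => ?_
    have := hr (ρ.asModuleEquiv.symm v) (Finset.mem_image_of_mem _ hv)
    have := congrArg ρ.asModuleEquiv this
    rw [asModuleEquiv_map_smul] at this
    simpa [F] using this
  rw [hf]
  clear hf hr
  induction r using MonoidAlgebra.induction_linear with
  | zero => simp
  | add x y hx hy => rw [map_add]; exact add_mem hx hy
  | single g a =>
    rw [asAlgebraHom_single]
    exact Submodule.smul_mem _ _ (Submodule.subset_span ⟨g, rfl⟩)

end Irreducible

section Descend

variable {k H Q V : Type*} [Field k] [Group H] [Group Q] [AddCommGroup V] [Module k V]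

/-- A representation that is trivial on the kernel of a surjection, as a representation of the
quotient. -/
noncomputable def descend (τ : Representation k H V) (f : H →* Q) (hf : Function.Surjective f)
    (hτ : ∀ h, f h = 1 → τ h = 1) : Representation k Q V :=
  have key : ∀ {a b}, f a = f b → τ a = τ b := fun {a b} e => by
    have := hτ (a * b⁻¹) (by rw [map_mul, map_inv, e, mul_inv_cancel])
    calc τ a = τ (a * b⁻¹) * τ b := by rw [← map_mul, inv_mul_cancel_right]
      _ = τ b := by rw [this, one_mul]
  { toFun := fun x => τ (Function.surjInv hf x)
    map_one' := hτ _ (Function.surjInv_eq hf 1)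
    map_mul' := fun x y => by
      rw [← map_mul]
      refine key ((Function.surjInv_eq hf _).trans ?_)
      rw [map_mul]
      exact congrArg₂ (· * ·) (Function.surjInv_eq hf x).symm (Function.surjInv_eq hf y).symm }

theorem descend_apply (τ : Representation k H V) (f : H →* Q) (hf : Function.Surjective f)
    (hτ : ∀ h, f h = 1 → τ h = 1) (h : H) : descend τ f hf hτ (f h) = τ h := by
  have := hτ (Function.surjInv hf (f h) * h⁻¹)
    (by
      have e : f (Function.surjInv hf (f h)) = f h := Function.surjInv_eq hf (f h)
      rw [map_mul, map_inv, e, mul_inv_cancel])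
  calc τ (Function.surjInv hf (f h)) = τ (Function.surjInv hf (f h) * h⁻¹) * τ h := by
        rw [← map_mul, inv_mul_cancel_right]
    _ = τ h := by rw [this, one_mul]

end Descend

section Tensor

variable {k A B H V W V' W' : Type*} [Field k] [Group A] [Group B] [Group H]
  [AddCommGroup V] [Module k V] [AddCommGroup W] [Module k W]
  [AddCommGroup V'] [Module k V'] [AddCommGroup W'] [Module k W']

theorem tmul_ne_zero {v : V} {w : W} (hv : v ≠ 0) (hw : w ≠ 0) : v ⊗ₜ[k] w ≠ 0 := by
  intro h
  obtain ⟨f, hf⟩ : ∃ f : Module.Dual k W, f w ≠ 0 := by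
    by_contra! hf
    exact hw ((Module.forall_dual_apply_eq_zero_iff k w).1 hf)
  have := congrArg (fun x => _root_.TensorProduct.rid k V (f.lTensor V x)) h
  simp [hf, hv] at this

/-- Vectors of a tensor product are told apart by contractions with functionals. -/
theorem exists_contraction_right_ne_zero {x : V ⊗[k] W} (hx : x ≠ 0) :
    ∃ f : W →ₗ[k] k, (_root_.TensorProduct.rid k V).toLinearMap (f.lTensor V x) ≠ 0 := by
  classical
  let b := Module.Basis.ofVectorSpace k W
  by_contra! h
  apply hx
  let e := _root_.TensorProduct.equivFinsuppOfBasisRight (M := V) b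
  apply e.injective
  rw [map_zero]
  ext i
  have := h (b.coord i)
  exact _root_.TensorProduct.equivFinsuppOfBasisRight_apply b x i |>.trans this

theorem exists_contraction_left_ne_zero {x : V ⊗[k] W} (hx : x ≠ 0) :
    ∃ f : V →ₗ[k] k, (_root_.TensorProduct.lid k W).toLinearMap (f.rTensor W x) ≠ 0 := by
  classical
  let b := Module.Basis.ofVectorSpace k V
  by_contra! h
  apply hx
  let e := _root_.TensorProduct.equivFinsuppOfBasisLeft (N := W) b
  apply e.injective
  rw [map_zero]
  ext i
  exact _root_.TensorProduct.equivFinsuppOfBasisLeft_apply b x i |>.trans (h (b.coord i))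

/-- The external tensor product of two irreducible representations is irreducible. By Burnside's
theorem a subspace that is stable under the first factor is stable under all operators `f ⊗ 1`, so
that it contains all pure tensors `v ⊗ w` as soon as it contains a vector with a coordinate `w`. -/
theorem IsIrreducible.tprod_comp [IsAlgClosed k] [FiniteDimensional k V]
    {ρ : Representation k A V} {σ : Representation k B W} (hρ : ρ.IsIrreducible)
    (hσ : σ.IsIrreducible) (p : H →* A) (q : H →* B) (hpq : ∀ a b, ∃ h, p h = a ∧ q h = b) :
    (tprod (ρ.comp p) (σ.comp q)).IsIrreducible := by
  have := hρ.nontrivial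
  have := hσ.nontrivial
  refine (isIrreducible_iff_submodule _).2 ⟨?_, fun S hS => ?_⟩
  · obtain ⟨v, hv⟩ := exists_ne (0 : V)
    obtain ⟨w, hw⟩ := exists_ne (0 : W)
    exact ⟨v ⊗ₜ w, 0, tmul_ne_zero hv hw⟩
  refine or_iff_not_imp_left.2 fun hne => ?_
  obtain ⟨x, hx, hx0⟩ := S.exists_mem_ne_zero_of_ne_bot hne
  have hA : ∀ f : V →ₗ[k] V, ∀ x ∈ S, f.rTensor W x ∈ S := by
    intro f
    have hf : f ∈ Submodule.span k (Set.range ρ) := hρ.span_range_eq_top ▸ Submodule.mem_top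
    induction hf using Submodule.span_induction with
    | mem f hf =>
      obtain ⟨a, rfl⟩ := hf
      obtain ⟨h, rfl, h2⟩ := hpq a 1
      intro x hx
      have := hS h x hx
      rwa [tprod_apply, MonoidHom.comp_apply, MonoidHom.comp_apply, h2, map_one] at this
    | zero => simp
    | add f g _ _ hf hg =>
      intro x hx
      rw [LinearMap.rTensor_add]
      exact add_mem (hf x hx) (hg x hx)
    | smul c f _ hf =>
      intro x hx
      rw [LinearMap.rTensor_smul]
      exact Submodule.smul_mem _ _ (hf x hx)
  have hB : ∀ b : B, ∀ x ∈ S, (σ b).lTensor V x ∈ S := by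
    intro b x hx
    obtain ⟨h, h1, rfl⟩ := hpq 1 b
    have := hS h x hx
    rwa [tprod_apply, MonoidHom.comp_apply, MonoidHom.comp_apply, h1, map_one] at this
  obtain ⟨f, hf⟩ := exists_contraction_left_ne_zero hx0
  set w := (_root_.TensorProduct.lid k W).toLinearMap (f.rTensor W x) with hw
  have hmem : ∀ v : V, v ⊗ₜ w ∈ S := by
    intro v
    have := hA ((LinearMap.toSpanSingleton k V v) ∘ₗ f) x hx
    convert this using 1
    rw [hw]
    clear this hw hf hx hx0
    clear_value w
    induction x using _root_.TensorProduct.induction_on with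
    | zero => simp
    | tmul a b => simp [_root_.TensorProduct.smul_tmul']
    | add a b ha hb => simp only [map_add, _root_.TensorProduct.tmul_add, ha, hb]
  let T : Submodule k W :=
    { carrier := {w | ∀ v : V, v ⊗ₜ[k] w ∈ S}
      add_mem' := fun ha hb v => by rw [_root_.TensorProduct.tmul_add]; exact add_mem (ha v) (hb v)
      zero_mem' := fun v => by rw [_root_.TensorProduct.tmul_zero]; exact zero_mem _
      smul_mem' := fun c w hw v => by
        rw [_root_.TensorProduct.tmul_smul]; exact Submodule.smul_mem _ _ (hw v) }
  have hT : T = ⊤ := hσ.eq_top (S := T) (fun b w hw v => by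
    simpa using hB b _ (hw v)) hmem hf
  rw [eq_top_iff, ← _root_.TensorProduct.span_tmul_eq_top, Submodule.span_le]
  rintro _ ⟨v, w, rfl⟩
  exact (hT ▸ Submodule.mem_top : w ∈ T) v

/-- Schur's lemma: a nonzero equivariant map between irreducible representations makes them
isomorphic. -/
theorem IsIrreducible.nonempty_equiv {ρ : Representation k A V} {ρ' : Representation k A V'}
    (hρ : ρ.IsIrreducible) (hρ' : ρ'.IsIrreducible) (f : ρ.IntertwiningMap ρ') (v : V)
    (hv : f v ≠ 0) : Nonempty (ρ.Equiv ρ') := by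
  have := (IsIrreducible.bijective_or_eq_zero f).resolve_right
    (fun h => hv (by rw [h]; rfl))
  exact ⟨f.ofBijective this⟩

/-- The left factor of an external tensor product of irreducible representations is determined by
the product: fixing a vector of the right factor and contracting the image with a functional gives a
nonzero map between the left factors. -/
theorem IsIrreducible.equiv_left_of_tprod_comp
    {ρ : Representation k A V} {σ : Representation k B W}
    {ρ' : Representation k A V'} {σ' : Representation k B W'} (hρ : ρ.IsIrreducible)
    (hσ : σ.IsIrreducible) (hρ' : ρ'.IsIrreducible)
    (p : H →* A) (q : H →* B) (hpq : ∀ a b, ∃ h, p h = a ∧ q h = b)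
    (φ : (tprod (ρ.comp p) (σ.comp q)).Equiv (tprod (ρ'.comp p) (σ'.comp q))) :
    Nonempty (ρ.Equiv ρ') := by
  have := hρ.nontrivial
  have := hσ.nontrivial
  obtain ⟨v, hv⟩ := exists_ne (0 : V)
  obtain ⟨w, hw⟩ := exists_ne (0 : W)
  have hne : φ (v ⊗ₜ[k] w) ≠ 0 := by
    rw [Ne, EmbeddingLike.map_eq_zero_iff]
    exact tmul_ne_zero hv hw
  obtain ⟨f, hf⟩ := exists_contraction_right_ne_zero hne
  refine hρ.nonempty_equiv hρ' (LinearMap.intertwiningMap_of_isIntertwiningMap ρ ρ'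
    ((_root_.TensorProduct.rid k V').toLinearMap ∘ₗ f.lTensor V' ∘ₗ φ.toLinearEquiv.toLinearMap ∘ₗ
      (_root_.TensorProduct.mk k V W).flip w) ?_) v hf
  intro a v
  obtain ⟨h, rfl, h2⟩ := hpq a 1
  have h1 := IntertwiningMap.isIntertwining _ _ φ.toIntertwiningMap h (v ⊗ₜ w)
  simp only [tprod_apply, MonoidHom.comp_apply, h2, map_one, _root_.TensorProduct.map_tmul,
    Module.End.one_apply] at h1
  have h1' : φ (ρ (p h) v ⊗ₜ w) = (ρ' (p h)).rTensor W' (φ (v ⊗ₜ w)) := h1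
  change (_root_.TensorProduct.rid k V') (f.lTensor V' (φ (ρ (p h) v ⊗ₜ w))) =
    ρ' (p h) ((_root_.TensorProduct.rid k V') (f.lTensor V' (φ (v ⊗ₜ w))))
  rw [h1']
  generalize φ (v ⊗ₜ w) = y
  induction y using _root_.TensorProduct.induction_on with
  | zero => simp
  | tmul a b => simp
  | add a b ha hb => simp only [map_add, ha, hb]

theorem IsIrreducible.equiv_right_of_tprod_comp
    {ρ : Representation k A V} {σ : Representation k B W}
    {ρ' : Representation k A V'} {σ' : Representation k B W'} (hρ : ρ.IsIrreducible)
    (hσ : σ.IsIrreducible) (hσ' : σ'.IsIrreducible)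
    (p : H →* A) (q : H →* B) (hpq : ∀ a b, ∃ h, p h = a ∧ q h = b)
    (φ : (tprod (ρ.comp p) (σ.comp q)).Equiv (tprod (ρ'.comp p) (σ'.comp q))) :
    Nonempty (σ.Equiv σ') := by
  exact hσ.equiv_left_of_tprod_comp hρ hσ' q p
    (fun b a => by obtain ⟨h, h1, h2⟩ := hpq a b; exact ⟨h, h2, h1⟩)
    (((TensorProduct.comm (ρ.comp p) (σ.comp q)).symm.trans φ).trans
      (TensorProduct.comm (ρ'.comp p) (σ'.comp q)))

/-- A representation `τ` of `H`, trivial on the common kernel of `p : H → A` and `q : H → B`,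
receives a nonzero equivariant map from the tensor product of an irreducible representation of `A` and one of
`B`; the first is found as a subrepresentation `V` of `τ`, the second as a subrepresentation of the
space of maps `V → τ` over `A`. -/
theorem exists_tprod_comp_map {k : Type*} [Field k] [Finite A] [Finite B]
    [NeZero (Nat.card A : k)] [NeZero (Nat.card B : k)] {X : Type u} [AddCommGroup X] [Module k X]
    [Nontrivial X] (τ : Representation k H X)
    (p : H →* A) (q : H →* B) (hpq : ∀ a b, ∃ h, p h = a ∧ q h = b)
    (hτ : ∀ h, p h = 1 → q h = 1 → τ h = 1) :
    ∃ (ρ : Rep.{u} k A) (σ : Rep.{u} k B) (i : ρ →ₗ[k] X),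
      ρ.ρ.IsIrreducible ∧ σ.ρ.IsIrreducible ∧ Function.Injective i ∧
      (∀ h, q h = 1 → ∀ v, i (ρ.ρ (p h) v) = τ h (i v)) ∧
      ∃ (F : (tprod (ρ.ρ.comp p) (σ.ρ.comp q)).IntertwiningMap τ) (x : ρ ⊗[k] σ), F x ≠ 0 := by
  have hsurj : Function.Surjective (p.prod q) := by
    rintro ⟨a, b⟩
    obtain ⟨h, rfl, rfl⟩ := hpq a b
    exact ⟨h, rfl⟩
  let θ : Representation k (A × B) X := τ.descend (p.prod q) hsurj
    (fun h e => by
      rw [MonoidHom.prod_apply, Prod.mk_eq_one] at e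
      exact hτ h e.1 e.2)
  have hθ : ∀ h, θ (p h, q h) = τ h := fun h => descend_apply τ (p.prod q) hsurj _ h
  obtain ⟨S, -, hS⟩ := exists_irreducible_subrepresentation_le
    (⊤ : Subrepresentation (θ.comp (MonoidHom.inl A B)))
    (fun e => top_ne_bot (congrArg Subrepresentation.toSubmodule e : (⊤ : Submodule k X) = ⊥))
  have hcomm : ∀ (a : A) (b : B) (x : X), θ (a, 1) (θ (1, b) x) = θ (1, b) (θ (a, 1) x) := by
    intro a b x
    rw [← Module.End.mul_apply, ← Module.End.mul_apply, ← map_mul, ← map_mul]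
    rw [Prod.mk_mul_mk, Prod.mk_mul_mk, one_mul, mul_one, one_mul, mul_one]
  -- the space of maps over `A`
  let E : Submodule k (S.toSubmodule →ₗ[k] X) :=
    { carrier := {f | ∀ a v, f (S.toRepresentation a v) = θ (a, 1) (f v)}
      add_mem' := fun hf hg a v => by simp [hf a v, hg a v]
      zero_mem' := fun a v => by simp
      smul_mem' := fun c f hf a v => by simp [hf a v] }
  let μ : Representation k B (S.toSubmodule →ₗ[k] X) :=
    { toFun := fun b => LinearMap.compRight k (θ (1, b))
      map_one' := by
        ext f v
        exact LinearMap.congr_fun (map_one θ) (f v)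
      map_mul' := fun b b' => by
        ext f v
        have : ((1 : A), b * b') = (1, b) * (1, b') := by rw [Prod.mk_mul_mk, one_mul]
        change θ (1, b * b') (f v) = θ (1, b) (θ (1, b') (f v))
        rw [this, map_mul, Module.End.mul_apply] }
  have hμ : ∀ b f v, μ b f v = θ (1, b) (f v) := fun _ _ _ => rfl
  let Es : Subrepresentation μ := ⟨E, fun b f hf a v => by rw [hμ, hμ, hf a v, hcomm]⟩
  have hE : S.toSubmodule.subtype ∈ E := fun a v => rfl
  have := hS.nontrivial
  have hEn : Es ≠ ⊥ := by
    intro e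
    obtain ⟨v, hv⟩ := exists_ne (0 : S.toSubmodule)
    have he : E = ⊥ := congrArg Subrepresentation.toSubmodule e
    rw [he, Submodule.mem_bot] at hE
    exact hv (Subtype.ext (LinearMap.congr_fun hE v))
  obtain ⟨L, hLE, hL⟩ := exists_irreducible_subrepresentation_le Es hEn
  let F : S.toSubmodule ⊗[k] L.toSubmodule →ₗ[k] X :=
    _root_.TensorProduct.lift (L.toSubmodule.subtype.flip)
  have hF : ∀ v f, F (v ⊗ₜ f) = f.1 v := fun _ _ => rfl
  have hFi : ∀ h x, F (tprod ((S.toRepresentation).comp p) ((L.toRepresentation).comp q) h x) =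
      τ h (F x) := by
    intro h x
    rw [← hθ]
    induction x using _root_.TensorProduct.induction_on with
    | zero => simp only [map_zero]
    | add a b ha hb => simp only [map_add, ha, hb]
    | tmul v f =>
      have e : ((p h, q h) : A × B) = (1, q h) * (p h, 1) := by simp
      rw [e, map_mul, tprod_apply, _root_.TensorProduct.map_tmul, hF, hF]
      exact congrArg (θ (1, q h)) (hLE f.2 (p h) v)
  have := hL.nontrivial
  obtain ⟨f, hf⟩ := exists_ne (0 : L.toSubmodule)
  obtain ⟨v, hv⟩ : ∃ v, f.1 v ≠ 0 := by
    by_contra! h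
    exact hf (Subtype.ext (LinearMap.ext h))
  refine ⟨Rep.of (X := S.toSubmodule) S.toRepresentation,
    Rep.of (X := L.toSubmodule) L.toRepresentation, S.toSubmodule.subtype, hS, hL,
    S.toSubmodule.subtype_injective, ?_,
    LinearMap.intertwiningMap_of_isIntertwiningMap _ _ F hFi, v ⊗ₜ f, hv⟩
  intro h hq v
  rw [← hθ, hq]
  rfl

end Tensor

end Representation

/-! ### Clifford theory -/

namespace Representation

section Clifford

variable {k G U U' W W' : Type*} [Field k] [Group G] [AddCommGroup U] [Module k U]
  [AddCommGroup W] [Module k W] [AddCommGroup U'] [Module k U'] [AddCommGroup W'] [Module k W']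
  {N : Subgroup G}

/-- The space of vectors on which the subgroup `N` acts through the character `χ`. -/
def charSpace (ρ : Representation k G U) (χ : N →* k) : Submodule k U where
  carrier := {v | ∀ n : N, ρ n v = χ n • v}
  add_mem' := fun hv hw n => by rw [map_add, hv n, hw n, smul_add]
  zero_mem' := fun n => by simp
  smul_mem' := fun c v hv n => by rw [map_smul, hv n, smul_comm]

/-- The conjugate character `n ↦ χ (g⁻¹ n g)`. -/
def conjChar [N.Normal] (χ : N →* k) (g : G) : N →* k :=
  χ.comp (MulAut.conjNormal g⁻¹).toMonoidHom

theorem conjChar_apply [N.Normal] (χ : N →* k) (g : G) (n : N) :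
    conjChar χ g n = χ (MulAut.conjNormal g⁻¹ n) := rfl

theorem apply_mem_charSpace [N.Normal] {ρ : Representation k G U} {χ : N →* k} {v : U}
    (hv : v ∈ charSpace ρ χ) (g : G) : ρ g v ∈ charSpace ρ (conjChar χ g) := by
  intro n
  have h : (n : G) * g = g * (MulAut.conjNormal g⁻¹ n : N) := by
    rw [MulAut.conjNormal_apply]; group
  rw [← Module.End.mul_apply, ← map_mul, h, map_mul, Module.End.mul_apply, hv, map_smul]
  rfl

/-- The projection onto the space of vectors on which `N` acts through `χ`. -/
noncomputable def charProj [Fintype N] (ρ : Representation k G U) (χ : N →* k) : U →ₗ[k] U :=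
  (Fintype.card N : k)⁻¹ • ∑ n : N, χ n⁻¹ • ρ n

theorem charProj_apply [Fintype N] (ρ : Representation k G U) (χ : N →* k) (v : U) :
    charProj ρ χ v = (Fintype.card N : k)⁻¹ • ∑ n : N, χ n⁻¹ • ρ n v := by
  simp [charProj]

theorem charProj_of_mem [Fintype N] [CharZero k] {ρ : Representation k G U} {χ : N →* k} {v : U}
    (hv : v ∈ charSpace ρ χ) : charProj ρ χ v = v := by
  have : ∀ n : N, χ n⁻¹ • ρ n v = v := fun n => by
    rw [hv n, smul_smul, ← map_mul, inv_mul_cancel, map_one, one_smul]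
  rw [charProj_apply, Finset.sum_congr rfl fun n _ => this n, Finset.sum_const, Finset.card_univ,
    ← Nat.cast_smul_eq_nsmul k, smul_smul, inv_mul_cancel₀, one_smul]
  exact_mod_cast Fintype.card_ne_zero

theorem charProj_of_mem_of_ne [Fintype N] {ρ : Representation k G U} {χ ψ : N →* k} {v : U}
    (hv : v ∈ charSpace ρ ψ) (h : ψ ≠ χ) : charProj ρ χ v = 0 := by
  classical
  let θ : N →* k :=
    { toFun := fun n => χ n⁻¹ * ψ n
      map_one' := by simp
      map_mul' := fun a b => by rw [mul_inv_rev, map_mul, map_mul]; ring }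
  have hθ : θ ≠ 1 := by
    intro e
    apply h
    ext n
    have h1 : χ n⁻¹ * ψ n = 1 := DFunLike.congr_fun e n
    have h2 : χ n * χ n⁻¹ = 1 := by rw [← map_mul, mul_inv_cancel, map_one]
    linear_combination χ n * h1 - ψ n * h2
  have := sum_hom_units_eq_zero θ hθ
  rw [charProj_apply, Finset.sum_congr rfl fun n _ => by rw [hv n, smul_smul],
    ← Finset.sum_smul]
  change _ • (∑ n, θ n) • v = 0
  rw [this, zero_smul, smul_zero]

/-- The situation of Clifford's theorem: the representation `ρ` of `G` is spanned by the translates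
of the image of an injective map `η` from a representation `σ` of the stabilizer `H` of the
character `χ` of `N`, and `N` acts on this image through `χ`. -/
structure IsCliffordInduced [N.Normal] (χ : N →* k) {H : Subgroup G} (σ : Representation k H W)
    (ρ : Representation k G U) (η : W →ₗ[k] U) : Prop where
  equivariant : ∀ (h : H) w, η (σ h w) = ρ h (η w)
  injective : Function.Injective η
  span : ∀ S : Submodule k U, (∀ g w, ρ g (η w) ∈ S) → S = ⊤
  isotypic : ∀ w, η w ∈ charSpace ρ χ
  stab : ∀ g, g ∈ H ↔ conjChar χ g = χ

namespace IsCliffordInduced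

variable [N.Normal] {χ : N →* k} {H : Subgroup G} {σ : Representation k H W}
    {ρ : Representation k G U} {η : W →ₗ[k] U} {σ' : Representation k H W'}
    {ρ' : Representation k G U'} {η' : W' →ₗ[k] U'}

theorem charProj_mem_range [Fintype N] [CharZero k] (h : IsCliffordInduced χ σ ρ η) (u : U) :
    charProj ρ χ u ∈ LinearMap.range η := by
  have : (LinearMap.range η).comap (charProj ρ χ) = ⊤ := by
    refine h.span _ fun g w => ?_
    have hm := apply_mem_charSpace (h.isotypic w) g
    rw [Submodule.mem_comap]
    by_cases hg : g ∈ H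
    · rw [(h.stab g).1 hg] at hm
      rw [charProj_of_mem hm]
      exact ⟨_, h.equivariant ⟨g, hg⟩ w⟩
    · rw [charProj_of_mem_of_ne hm (fun e => hg ((h.stab g).2 e))]
      exact zero_mem _
  exact (this ▸ Submodule.mem_top : u ∈ (LinearMap.range η).comap (charProj ρ χ))

theorem mem_range_of_mem_charSpace [Finite N] [CharZero k] (h : IsCliffordInduced χ σ ρ η) {u : U}
    (hu : u ∈ charSpace ρ χ) : u ∈ LinearMap.range η := by
  have := Fintype.ofFinite N
  exact charProj_of_mem hu ▸ h.charProj_mem_range u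

/-- The sum of the conjugates of the projection onto the `χ`-space is a positive multiple of the
identity, so that every nonzero vector has a translate with a nonzero projection. -/
theorem exists_charProj_ne_zero [Finite G] [Fintype N] [CharZero k]
    (h : IsCliffordInduced χ σ ρ η) {u : U} (hu : u ≠ 0) :
    ∃ g : G, charProj ρ χ (ρ g u) ≠ 0 := by
  classical
  have := Fintype.ofFinite G
  by_contra! h0
  -- `P` commutes with `G`, so that it is enough to compute it on the image of `η`
  let P : U →ₗ[k] U := ∑ g : G, ρ g⁻¹ ∘ₗ charProj ρ χ ∘ₗ ρ g
  have hP : ∀ v, P v = ∑ g : G, ρ g⁻¹ (charProj ρ χ (ρ g v)) := fun v => by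
    simp [P]
  have hcomm : ∀ g v, P (ρ g v) = ρ g (P v) := by
    intro g v
    rw [hP, hP, map_sum]
    refine Fintype.sum_equiv (Equiv.mulRight g) _ _ fun x => ?_
    simp only [Equiv.coe_mulRight, mul_inv_rev, ← Module.End.mul_apply, ← map_mul]
    rw [← mul_assoc, ← mul_assoc (ρ g), ← map_mul, mul_inv_cancel_left]
    rfl
  have hη : ∀ w, P (η w) = (Nat.card H : k) • η w := by
    intro w
    have : ∀ g : G, ρ g⁻¹ (charProj ρ χ (ρ g (η w))) = if g ∈ H then η w else 0 := by
      intro g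
      have hm := apply_mem_charSpace (h.isotypic w) g
      split_ifs with hg
      · rw [(h.stab g).1 hg] at hm
        rw [charProj_of_mem hm, ← Module.End.mul_apply, ← map_mul, inv_mul_cancel, map_one,
          Module.End.one_apply]
      · rw [charProj_of_mem_of_ne hm (fun e => hg ((h.stab g).2 e)), map_zero]
    rw [hP, Finset.sum_congr rfl fun g _ => this g, Finset.sum_ite, Finset.sum_const,
      Finset.sum_const_zero, add_zero, ← Nat.cast_smul_eq_nsmul k, Nat.card_eq_fintype_card,
      Fintype.card_subtype]
  have htop : LinearMap.ker (P - (Nat.card H : k) • LinearMap.id) = ⊤ := by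
    refine h.span _ fun g w => ?_
    rw [LinearMap.mem_ker, LinearMap.sub_apply, hcomm, hη, map_smul, LinearMap.smul_apply,
      LinearMap.id_apply, sub_self]
  have hPu : P u = (Nat.card H : k) • u := by
    have : u ∈ LinearMap.ker (P - (Nat.card H : k) • LinearMap.id) := htop ▸ Submodule.mem_top
    rw [LinearMap.mem_ker, LinearMap.sub_apply, sub_eq_zero] at this
    simpa using this
  rw [hP, Finset.sum_eq_zero fun g _ => by rw [h0 g, map_zero]] at hPu
  refine (smul_ne_zero ?_ hu) hPu.symm
  exact_mod_cast Nat.card_pos.ne'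

theorem isIrreducible [Finite G] [CharZero k] (h : IsCliffordInduced χ σ ρ η)
    (hσ : σ.IsIrreducible) : ρ.IsIrreducible := by
  have := Fintype.ofFinite N
  have := hσ.nontrivial
  refine (isIrreducible_iff_submodule _).2 ⟨h.injective.nontrivial, fun S hS => ?_⟩
  refine or_iff_not_imp_left.2 fun hne => ?_
  obtain ⟨u, hu, hu0⟩ := S.exists_mem_ne_zero_of_ne_bot hne
  obtain ⟨g, hg⟩ := h.exists_charProj_ne_zero hu0
  have hmem : charProj ρ χ (ρ g u) ∈ S := by
    rw [charProj_apply]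
    exact S.smul_mem _ (S.sum_mem fun n _ => S.smul_mem _ (hS _ _ (hS _ _ hu)))
  obtain ⟨w, hw⟩ := h.charProj_mem_range (ρ g u)
  have hT : S.comap η = ⊤ := by
    refine hσ.eq_top (fun x w hw => ?_) (v := w) ?_ ?_
    · rw [Submodule.mem_comap, h.equivariant]
      exact hS _ _ hw
    · rw [Submodule.mem_comap, hw]; exact hmem
    · rintro rfl
      exact hg (by rw [← hw, map_zero])
  exact h.span S fun g w => hS _ _ (hT ▸ Submodule.mem_top : w ∈ S.comap η)

/-- The characters of `N` that occur in `ρ` are the conjugates of `χ`. -/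
theorem exists_conjChar_eq [Finite N] [CharZero k] (h : IsCliffordInduced χ σ ρ η) {ψ : N →* k}
    {u : U} (hu : u ∈ charSpace ρ ψ) (hu0 : u ≠ 0) : ∃ g, conjChar χ g = ψ := by
  have := Fintype.ofFinite N
  by_contra! hne
  have : LinearMap.ker (charProj ρ ψ) = ⊤ := h.span _ fun g w =>
    charProj_of_mem_of_ne (apply_mem_charSpace (h.isotypic w) g) (hne g)
  have hk : u ∈ LinearMap.ker (charProj ρ ψ) := this ▸ Submodule.mem_top
  rw [LinearMap.mem_ker, charProj_of_mem hu] at hk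
  exact hu0 hk

/-- Isomorphic representations induced from the stabilizers of two characters involve the same
conjugacy class of characters. -/
theorem exists_conjChar_eq_of_equiv [Finite N] [CharZero k] [Nontrivial W'] {χ' : N →* k}
    {H' : Subgroup G} {σ' : Representation k H' W'} (h : IsCliffordInduced χ σ ρ η)
    (h' : IsCliffordInduced χ' σ' ρ' η') (φ : ρ.Equiv ρ') : ∃ g, conjChar χ g = χ' := by
  obtain ⟨w, hw⟩ := exists_ne (0 : W')
  refine h.exists_conjChar_eq (u := φ.symm (η' w)) (fun n => ?_) ?_
  · have := IntertwiningMap.isIntertwining _ _ φ.symm.toIntertwiningMap (n : G) (η' w)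
    rw [h'.isotypic w n, map_smul] at this
    exact this.symm
  · rw [Ne, EmbeddingLike.map_eq_zero_iff]
    exact fun e => hw (h'.injective (e.trans (map_zero η').symm))

/-- The representation `σ` is recovered from `ρ` as the space where `N` acts through `χ`. -/
theorem nonempty_equiv [Finite N] [CharZero k] (h : IsCliffordInduced χ σ ρ η)
    (h' : IsCliffordInduced χ σ' ρ' η') (φ : ρ.Equiv ρ') (hσ : σ.IsIrreducible)
    (hσ' : σ'.IsIrreducible) : Nonempty (σ.Equiv σ') := by
  have hφ : ∀ g u, φ (ρ g u) = ρ' g (φ u) := fun g u =>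
    IntertwiningMap.isIntertwining _ _ φ.toIntertwiningMap g u
  have hr : ∀ w, ∃ w', η' w' = φ (η w) := fun w =>
    h'.mem_range_of_mem_charSpace fun n => by
      rw [← hφ, h.isotypic w n, map_smul]
  choose f hf using hr
  let F : W →ₗ[k] W' :=
    { toFun := f
      map_add' := fun a b => h'.injective (by rw [map_add, hf, hf, hf, map_add, map_add])
      map_smul' := fun c a => h'.injective (by
        rw [RingHom.id_apply, map_smul, hf, hf, map_smul, map_smul]) }
  have := hσ.nontrivial
  obtain ⟨w, hw⟩ := exists_ne (0 : W)
  refine hσ.nonempty_equiv hσ' (LinearMap.intertwiningMap_of_isIntertwiningMap σ σ' F ?_) w ?_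
  · intro g w
    apply h'.injective
    rw [h'.equivariant]
    change η' (f _) = ρ' g (η' (f w))
    rw [hf, hf, h.equivariant, hφ]
  · change f w ≠ 0
    intro e
    have := hf w
    rw [e, map_zero, eq_comm, EmbeddingLike.map_eq_zero_iff] at this
    exact hw (h.injective (this.trans (map_zero η).symm))

end IsCliffordInduced

section Ind

variable {H : Subgroup G} (σ : Representation k H W)

theorem ind_mk_one (g : G) (w : W) :
    ind H.subtype σ g (IndV.mk H.subtype σ 1 w) = IndV.mk H.subtype σ g⁻¹ w := by
  rw [ind_mk, one_mul]

theorem indV_mk_mul (h : H) (g : G) (w : W) :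
    IndV.mk H.subtype σ (h * g) (σ h w) = IndV.mk H.subtype σ g w := by
  have := Coinvariants.mk_self_apply (tprod ((leftRegular k G).comp H.subtype) σ) h
    (MonoidAlgebra.single g 1 ⊗ₜ w)
  simpa using this

theorem indV_eq_top (S : Submodule k (IndV H.subtype σ))
    (hS : ∀ g w, IndV.mk H.subtype σ g w ∈ S) : S = ⊤ := by
  have : S.mkQ = 0 := IndV.hom_ext _ _ fun g => by
    ext w
    simpa using hS g w
  rw [← S.ker_mkQ, this, LinearMap.ker_zero]

/-- Frobenius reciprocity: the map from the induced representation given by an equivariant map. -/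
noncomputable def indLift (τ : Representation k G U) (f : W →ₗ[k] U)
    (hf : ∀ (h : H) w, f (σ h w) = τ h (f w)) : (ind H.subtype σ).IntertwiningMap τ :=
  ⟨Coinvariants.lift _
      (_root_.TensorProduct.lift <| (Finsupp.lift _ _ _ fun g => τ g⁻¹ ∘ₗ f) ∘ₗ
        (MonoidAlgebra.coeffLinearEquiv k).toLinearMap)
      fun h => by
        ext g w
        simp [hf],
    fun g => by ext; simp⟩

theorem indLift_mk_one (τ : Representation k G U) (f : W →ₗ[k] U)
    (hf : ∀ (h : H) w, f (σ h w) = τ h (f w)) (w : W) :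
    indLift σ τ f hf (IndV.mk H.subtype σ 1 w) = f w := by
  simp [indLift]

theorem indV_mk_one_injective : Function.Injective (IndV.mk H.subtype σ 1) := by
  classical
  -- the left inverse sends `⟦g ⊗ w⟧` to `g⁻¹ w` for `g` in `H`, and to `0` for the other `g`
  let F : IndV H.subtype σ →ₗ[k] W := Coinvariants.lift _
      (_root_.TensorProduct.lift <|
        (Finsupp.lift _ _ _ fun g : G => if hg : g ∈ H then σ ⟨g, hg⟩⁻¹ else 0) ∘ₗ
        (MonoidAlgebra.coeffLinearEquiv k).toLinearMap)
      fun h => by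
        ext g w
        by_cases hg : g ∈ H
        · have hm : (h : G) * g ∈ H := H.mul_mem h.2 hg
          have e : (⟨h * g, hm⟩ : H)⁻¹ * h = ⟨g, hg⟩⁻¹ := by ext; simp
          have : σ ⟨h * g, hm⟩⁻¹ (σ h w) = σ ⟨g, hg⟩⁻¹ w := by
            rw [← Module.End.mul_apply, ← map_mul, e]
          simpa [hg, hm] using this
        · simp [hg, Subgroup.mul_mem_cancel_left]
  refine Function.LeftInverse.injective (g := F) fun w => ?_
  simp [F, show (⟨1, H.one_mem⟩ : H) = 1 from rfl]

theorem isCliffordInduced_ind [N.Normal] (χ : N →* k) (hN : ∀ n : N, (n : G) ∈ H)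
    (hσ : ∀ (n : N) w, σ ⟨n, hN n⟩ w = χ n • w) (hH : ∀ g, g ∈ H ↔ conjChar χ g = χ) :
    IsCliffordInduced χ σ (ind H.subtype σ) (IndV.mk H.subtype σ 1) := by
  have heq : ∀ (h : H) w, IndV.mk H.subtype σ 1 (σ h w) =
      ind H.subtype σ h (IndV.mk H.subtype σ 1 w) := fun h w => by
    rw [ind_mk_one, ← indV_mk_mul σ h (h : G)⁻¹, mul_inv_cancel]
  refine ⟨heq, indV_mk_one_injective σ, fun S hS => ?_, fun w n => ?_, hH⟩
  · refine indV_eq_top σ S fun g w => ?_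
    have := hS g⁻¹ w
    rwa [ind_mk_one, inv_inv] at this
  · rw [← heq ⟨n, hN n⟩, hσ, map_smul]

end Ind

end Clifford

end Representation

/-! ### The characters of the image of the pure braid group -/

namespace BraidRep

noncomputable section

theorem two_mul_dev {n : ℕ} (β : Braid n) (a b : Fin n) : 2 * dev β a b = 0 := by
  rw [dev, mul_sub, M_two_apply]
  simp only [EmbeddingLike.apply_eq_iff_eq]
  split_ifs <;> simp

theorem dev_eq_two {n : ℕ} {β : Braid n} {a b : Fin n} (h : dev β a b ≠ 0) : dev β a b = 2 := by
  have key : ∀ x : ZMod 4, 2 * x = 0 → x ≠ 0 → x = 2 := by decide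
  exact key _ (two_mul_dev β a b) h

/-- The asymmetry of `dev β` at a pair of positions records whether `β` exchanges the order of
these two strands. -/
theorem dev_sub_dev {n : ℕ} (β : Braid n) (a b : Fin n) (hab : a ≠ b) :
    dev β a b - dev β b a =
      if (a < b ↔ (perm n β)⁻¹ a < (perm n β)⁻¹ b) then 0 else 2 := by
  have h4 : (2 : ZMod 4) + 2 = 0 := by decide
  have key : ∀ (p q r : Prop) [Decidable p] [Decidable q] [Decidable r],
      ((if (p ↔ q) then 0 else 2) + (if (q ↔ r) then 0 else 2) : ZMod 4) =
      if (p ↔ r) then 0 else 2 := by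
    intro p q r _ _ _
    by_cases p <;> by_cases q <;> by_cases r <;> simp_all
  have h2 : -(2 : ZMod 4) = 2 := by decide
  refine Braid.induction (fun β => ∀ a b : Fin n, a ≠ b → dev β a b - dev β b a =
      if (a < b ↔ (perm n β)⁻¹ a < (perm n β)⁻¹ b) then 0 else 2) ?_ ?_ ?_ ?_ β a b hab
  · intro a b _
    simp [dev_one]
  · intro i a b hab
    have h := lo_ne_hi i
    have hlt : lo i < hi i := by simp [lo, hi, Fin.lt_def]
    rw [dev_of _ _ _ hab, dev_of _ _ _ hab.symm, perm_of, Equiv.swap_inv]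
    by_cases h1 : a = lo i ∧ b = hi i
    · obtain ⟨rfl, rfl⟩ := h1
      simp [h, hlt, hlt.le]
    · by_cases h3 : b = lo i ∧ a = hi i
      · obtain ⟨rfl, rfl⟩ := h3
        simp [h, hlt, hlt.le, h2]
      · rw [if_neg h1, if_neg h3, sub_zero, if_pos]
        constructor
        · intro hl
          exact swap_lt hl h1
        · intro hl
          by_contra hl'
          exact absurd hl (swap_lt (lt_of_le_of_ne (not_lt.1 hl') hab.symm) h3).asymm
  · intro x y hx hy a b hab
    have e1 := hx a b hab
    have e2 := hy ((perm n x)⁻¹ a) ((perm n x)⁻¹ b) (by simpa using hab)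
    rw [dev_mul, dev_mul, add_sub_add_comm, e1, e2, map_mul, mul_inv_rev, Equiv.Perm.mul_apply,
      Equiv.Perm.mul_apply]
    exact key _ _ _
  · intro x hx a b hab
    have e1 := hx (perm n x a) (perm n x b) (by simpa using hab)
    rw [← Equiv.Perm.mul_apply, ← Equiv.Perm.mul_apply, inv_mul_cancel, Equiv.Perm.one_apply,
      Equiv.Perm.one_apply] at e1
    rw [dev_inv, dev_inv, map_inv, inv_inv, neg_sub_neg, ← neg_sub, e1]
    simp only [iff_comm (a := a < b)]
    split_ifs
    · exact neg_zero
    · exact h2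

theorem mem_pureBraid {n : ℕ} {β : Braid n} : β ∈ pureBraid n ↔ perm n β = 1 := Iff.rfl

theorem dev_symm {n : ℕ} {β : Braid n} (hβ : β ∈ pureBraid n) (a b : Fin n) (hab : a ≠ b) :
    dev β a b = dev β b a := by
  rw [← sub_eq_zero, dev_sub_dev β a b hab, mem_pureBraid.1 hβ]
  simp

theorem dev_mul_of_mem {n : ℕ} {β : Braid n} (hβ : β ∈ pureBraid n) (γ : Braid n) (a b : Fin n) :
    dev (β * γ) a b = dev β a b + dev γ a b := by
  rw [dev_mul, mem_pureBraid.1 hβ]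
  simp

theorem dev_conj {n : ℕ} {β : Braid n} (hβ : β ∈ pureBraid n) (γ : Braid n) (a b : Fin n) :
    dev (γ * β * γ⁻¹) a b = dev β ((perm n γ)⁻¹ a) ((perm n γ)⁻¹ b) := by
  rw [dev_mul, dev_mul, dev_inv, map_mul, mem_pureBraid.1 hβ, mul_one]
  simp

/-- The value of `dev β` at the pair `p`, with the smaller position first. -/
def pairDev {n : ℕ} (β : Braid n) (p : Sub n 2) : ZMod 4 := dev β (emb p 0) (emb p 1)

theorem emb_zero_ne_one {n : ℕ} (p : Sub n 2) : emb p 0 ≠ emb p 1 := by simp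

theorem sub_two_eq {n : ℕ} (p : Sub n 2) : p.1 = {emb p 0, emb p 1} := by
  refine (Finset.eq_of_subset_of_card_le ?_ ?_).symm
  · intro x hx
    rw [Finset.mem_insert, Finset.mem_singleton] at hx
    rcases hx with rfl | rfl <;> exact emb_mem _ _
  · rw [Finset.card_pair (emb_zero_ne_one p)]
    exact p.2.le

theorem pairDev_eq {n : ℕ} {β : Braid n} (hβ : β ∈ pureBraid n) {p : Sub n 2} {a b : Fin n}
    (hab : a ≠ b) (ha : a ∈ p.1) (hb : b ∈ p.1) : pairDev β p = dev β a b := by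
  rw [sub_two_eq, Finset.mem_insert, Finset.mem_singleton] at ha hb
  rcases ha with rfl | rfl <;> rcases hb with rfl | rfl
  · exact absurd rfl hab
  · rfl
  · exact dev_symm hβ _ _ hab.symm
  · exact absurd rfl hab

/-- The pair of two distinct positions. -/
def pair {n : ℕ} (a b : Fin n) (hab : a ≠ b) : Sub n 2 :=
  ⟨{a, b}, Finset.card_pair hab⟩

theorem dev_eq_zero_of_pairDev {n : ℕ} {β : Braid n} (hβ : β ∈ pureBraid n)
    (h : ∀ p, pairDev β p = 0) (a b : Fin n) (hab : a ≠ b) : dev β a b = 0 := by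
  rw [← pairDev_eq hβ (p := pair a b hab) hab (by simp [pair]) (by simp [pair]), h]

theorem exists_pair_eq {n : ℕ} (p : Sub n 2) : ∃ (i d : ℕ) (h : i + d + 1 < n),
    p.1 = {(⟨i, by omega⟩ : Fin n), ⟨i + d + 1, h⟩} := by
  have hlt : emb p 0 < emb p 1 := by simp
  have hlt' : (emb p 0 : ℕ) < emb p 1 := hlt
  have h1 := (emb p 1).2
  refine ⟨emb p 0, emb p 1 - emb p 0 - 1, by omega, ?_⟩
  rw [sub_two_eq p]
  congr 2
  ext
  simp only
  omega

/-- The Artin generator `T_{i,j}` has deviation `2` at `{i, j}` and `0` at all other pairs. -/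
theorem dev_artinTwist {n : ℕ} (i d : ℕ) (h : i + d + 1 < n) (a b : Fin n) (hab : a ≠ b) :
    dev (artinTwist n i d) a b =
      if ((a : ℕ) = i ∧ (b : ℕ) = i + d + 1) ∨ ((b : ℕ) = i ∧ (a : ℕ) = i + d + 1)
        then 2 else 0 := by
  induction d generalizing a b with
  | zero =>
    have hi' : i < n - 1 := by omega
    have e : σ n i = PresentedGroup.of ⟨i, hi'⟩ := σ_fin ⟨i, hi'⟩
    rw [artinTwist, pow_two, dev_mul, e, perm_of, dev_of _ _ _ hab,
      dev_of _ _ _ (by simpa using hab),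
      Equiv.swap_inv]
    have h1 := lo_ne_hi (⟨i, hi'⟩ : Fin (n - 1))
    have h2 : ∀ x : Fin n, (x : ℕ) = i ↔ x = lo ⟨i, hi'⟩ := fun x => by simp [lo, Fin.ext_iff]
    have h3 : ∀ x : Fin n, (x : ℕ) = i + 0 + 1 ↔ x = hi ⟨i, hi'⟩ := fun x => by
      simp [hi, Fin.ext_iff]
    simp only [h2, h3, Equiv.swap_apply_eq_iff, Equiv.swap_apply_left, Equiv.swap_apply_right]
    split_ifs <;> first | (simp_all; done) | (exfalso; tauto)
  | succ d ih =>
    have hj' : i + d + 1 < n - 1 := by omega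
    have e : σ n (i + d + 1) = PresentedGroup.of ⟨i + d + 1, hj'⟩ := σ_fin ⟨i + d + 1, hj'⟩
    rw [artinTwist, dev_conj (artinTwist_mem n i d), ih (by omega) _ _ (by simpa using hab), e,
      perm_of, Equiv.swap_inv]
    congr 1
    simp only [Equiv.swap_apply_def, lo, hi, Fin.ext_iff]
    grind

/-- The sign character of the subgroup `{0, 2}` of `ℤ/4`. -/
def sgn (x : ZMod 4) : ℤˣ := if x = 0 then 1 else -1

theorem sgn_add {x y : ZMod 4} (hx : 2 * x = 0) (hy : 2 * y = 0) :
    sgn (x + y) = sgn x * sgn y := by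
  revert x y
  decide

theorem sgn_zero : sgn 0 = 1 := rfl

theorem sgn_two : sgn 2 = -1 := by decide

/-- The projection of the pure braid group onto its image in `Z n`. -/
def toPZ (n : ℕ) : pureBraid n →* PZ n := (QuotientGroup.mk' (level n 4)).subgroupMap (pureBraid n)

theorem toPZ_surjective (n : ℕ) : Function.Surjective (toPZ n) :=
  MonoidHom.subgroupMap_surjective _ _

theorem toPZ_eq_one_iff {n : ℕ} (β : pureBraid n) : toPZ n β = 1 ↔ ∀ p, pairDev β.1 p = 0 := by
  have : toPZ n β = 1 ↔ β.1 ∈ level n 4 := by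
    rw [← QuotientGroup.eq_one_iff, Subtype.ext_iff]; rfl
  rw [this, mem_level_iff]
  exact ⟨fun h p => h.2 _ _ (emb_zero_ne_one p), fun h => ⟨β.2, dev_eq_zero_of_pairDev β.2 h⟩⟩

theorem pairDev_mul {n : ℕ} (β γ : pureBraid n) (p : Sub n 2) :
    pairDev (β * γ : pureBraid n).1 p = pairDev β.1 p + pairDev γ.1 p :=
  dev_mul_of_mem β.2 γ.1 _ _

theorem pairDev_inv {n : ℕ} (β : pureBraid n) (p : Sub n 2) :
    pairDev (β⁻¹ : pureBraid n).1 p = - pairDev β.1 p := by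
  have := pairDev_mul β β⁻¹ p
  rw [mul_inv_cancel] at this
  have h1 : pairDev (1 : pureBraid n).1 p = 0 := dev_one _ _
  linear_combination h1 - this

theorem toPZ_eq_iff {n : ℕ} (β γ : pureBraid n) :
    toPZ n β = toPZ n γ ↔ ∀ p, pairDev β.1 p = pairDev γ.1 p := by
  rw [← mul_inv_eq_one, ← map_inv, ← map_mul, toPZ_eq_one_iff]
  simp only [pairDev_mul, pairDev_inv, ← sub_eq_add_neg, sub_eq_zero]

theorem PZ_mul_comm {n : ℕ} (x y : PZ n) : x * y = y * x := by
  obtain ⟨β, rfl⟩ := toPZ_surjective n x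
  obtain ⟨γ, rfl⟩ := toPZ_surjective n y
  rw [← map_mul, ← map_mul, toPZ_eq_iff]
  intro p
  rw [pairDev_mul, pairDev_mul, add_comm]

theorem PZ_mul_self {n : ℕ} (x : PZ n) : x * x = 1 := by
  obtain ⟨β, rfl⟩ := toPZ_surjective n x
  rw [← map_mul, toPZ_eq_one_iff]
  intro p
  rw [pairDev_mul, ← two_mul]
  exact two_mul_dev _ _ _

open scoped Classical in
/-- The character of `PZ n` that corresponds to the set `I` of pairs. -/
def pairChar {n : ℕ} (I : Set (Sub n 2)) : PZ n →* ℤˣ :=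
  (toPZ n).liftOfSurjective (toPZ_surjective n)
    ⟨{ toFun := fun β => ∏ p : Sub n 2, if p ∈ I then sgn (pairDev β.1 p) else 1
       map_one' := Finset.prod_eq_one fun p _ => by
        rw [show pairDev (1 : pureBraid n).1 p = 0 from dev_one _ _, sgn_zero, ite_self]
       map_mul' := fun β γ => by
        rw [← Finset.prod_mul_distrib]
        refine Finset.prod_congr rfl fun p _ => ?_
        split_ifs
        · rw [pairDev_mul, pairDev, pairDev, sgn_add (two_mul_dev _ _ _) (two_mul_dev _ _ _)]
        · rw [mul_one] },
      fun β hβ => by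
        rw [MonoidHom.mem_ker, toPZ_eq_one_iff] at hβ
        exact Finset.prod_eq_one fun p _ => by rw [hβ p, sgn_zero, ite_self]⟩

open scoped Classical in
theorem pairChar_toPZ {n : ℕ} (I : Set (Sub n 2)) (β : pureBraid n) :
    pairChar I (toPZ n β) = ∏ p : Sub n 2, if p ∈ I then sgn (pairDev β.1 p) else 1 :=
  MonoidHom.liftOfRightInverse_comp_apply _ _ _ _ _

open scoped Classical in
theorem pairDev_artinTwist {n : ℕ} (i d : ℕ) (h : i + d + 1 < n) (p : Sub n 2)
    (hp : p.1 = {(⟨i, by omega⟩ : Fin n), ⟨i + d + 1, h⟩}) (q : Sub n 2) :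
    pairDev (artinTwist n i d) q = if q = p then 2 else 0 := by
  have hlt : (emb q 0 : ℕ) < emb q 1 := (by simp : emb q 0 < emb q 1)
  rw [pairDev, dev_artinTwist i d h _ _ (emb_zero_ne_one q)]
  congr 1
  rw [Subtype.ext_iff, sub_two_eq q, hp]
  simp only [eq_iff_iff]
  constructor
  · rintro (h | h)
    · congr 2 <;> ext <;> simp [h]
    · omega
  · intro e
    have h0 : emb q 0 ∈ ({emb q 0, emb q 1} : Finset (Fin n)) := by simp
    have h1 : emb q 1 ∈ ({emb q 0, emb q 1} : Finset (Fin n)) := by simp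
    rw [e] at h0 h1
    simp only [Finset.mem_insert, Finset.mem_singleton, Fin.ext_iff] at h0 h1
    omega

theorem pairChar_artinZ {n : ℕ} (I : Set (Sub n 2)) (i d : ℕ) (h : i + d + 1 < n) (p : Sub n 2)
    (hp : p.1 = {(⟨i, by omega⟩ : Fin n), ⟨i + d + 1, h⟩}) [Decidable (p ∈ I)] :
    pairChar I (artinZ n i d) = if p ∈ I then -1 else 1 := by
  classical
  have e : artinZ n i d = toPZ n ⟨artinTwist n i d, artinTwist_mem n i d⟩ := rfl
  rw [e, pairChar_toPZ, Finset.prod_eq_single p]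
  · rw [pairDev_artinTwist i d h p hp, if_pos rfl, sgn_two]
    congr
  · intro q _ hq
    rw [pairDev_artinTwist i d h p hp, if_neg hq, sgn_zero, ite_self]
  · simp

theorem isPairCharacter_pairChar {n : ℕ} (I : Set (Sub n 2)) : IsPairCharacter I (pairChar I) := by
  classical
  intro i d h p hp
  rw [pairChar_artinZ I i d h p hp]
  exact ⟨fun h => if_pos h, fun h => if_neg h⟩

theorem pairChar_injective {n : ℕ} : Function.Injective (pairChar (n := n)) := by
  classical
  intro I J hIJ
  ext p
  obtain ⟨i, d, h, hp⟩ := exists_pair_eq p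
  have e := DFunLike.congr_fun hIJ (artinZ n i d)
  rw [pairChar_artinZ I i d h p hp, pairChar_artinZ J i d h p hp] at e
  by_cases h1 : p ∈ I <;> by_cases h2 : p ∈ J <;> simp [h1, h2] at e ⊢

/-- The group `PZ n` is generated by the Artin generators. -/
theorem closure_artinZ (n : ℕ) :
    Subgroup.closure {x | ∃ i d, i + d + 1 < n ∧ x = artinZ n i d} = ⊤ := by
  classical
  -- a pure braid whose deviation is supported in `s` is corrected at one pair of `s` at a time
  have key : ∀ (s : Finset (Sub n 2)) (β : pureBraid n), (∀ p ∉ s, pairDev β.1 p = 0) →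
      toPZ n β ∈ Subgroup.closure {x | ∃ i d, i + d + 1 < n ∧ x = artinZ n i d} := by
    intro s
    induction s using Finset.induction with
    | empty =>
      intro β hβ
      rw [(toPZ_eq_one_iff β).2 fun p => hβ p (Finset.notMem_empty p)]
      exact one_mem _
    | insert q s hq ih =>
      intro β hβ
      by_cases h0 : pairDev β.1 q = 0
      · refine ih β fun p hp => ?_
        by_cases hpq : p = q
        · rw [hpq, h0]
        · exact hβ p (by simp [hp, hpq])
      · obtain ⟨i, d, h, hp⟩ := exists_pair_eq q
        let t : pureBraid n := ⟨artinTwist n i d, artinTwist_mem n i d⟩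
        have ht : toPZ n t ∈ Subgroup.closure {x | ∃ i d, i + d + 1 < n ∧ x = artinZ n i d} :=
          Subgroup.subset_closure ⟨i, d, h, rfl⟩
        have := ih (β * t) fun p hps => by
          rw [pairDev_mul, pairDev_artinTwist i d h q hp]
          split_ifs with hpq
          · rw [hpq, pairDev, dev_eq_two h0]
            decide
          · rw [hβ p (by simp [hps, hpq]), add_zero]
        rw [map_mul] at this
        exact (Subgroup.mul_mem_cancel_right _ ht).1 this
  rw [eq_top_iff]
  intro x _
  obtain ⟨β, rfl⟩ := toPZ_surjective n x
  exact key Finset.univ β fun p hp => absurd (Finset.mem_univ p) hp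

theorem IsPairCharacter.eq_pairChar {n : ℕ} {I : Set (Sub n 2)} {χ : PZ n →* ℤˣ}
    (h : IsPairCharacter I χ) : χ = pairChar I := by
  classical
  refine MonoidHom.eq_of_eqOn_dense (closure_artinZ n) ?_
  rintro _ ⟨i, d, hid, rfl⟩
  have hne : (⟨i, by omega⟩ : Fin n) ≠ ⟨i + d + 1, hid⟩ := by simp [Fin.ext_iff]; omega
  have e := h i d hid (pair _ _ hne) rfl
  rw [pairChar_artinZ I i d hid (pair _ _ hne) rfl]
  split_ifs with hp
  · exact e.1 hp
  · exact e.2 hp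

instance (n : ℕ) : (pureBraid n).Normal := by unfold pureBraid; infer_instance

instance (n : ℕ) : (PZ n).Normal :=
  Subgroup.Normal.map inferInstance _ (QuotientGroup.mk'_surjective _)

instance (n : ℕ) : Finite (Z n) :=
  Finite.of_injective _ (QuotientGroup.kerLift_injective (burauMod n 4))

/-- A braid conjugates the character of `I` to that of the translate of `I` by its permutation. -/
theorem pairChar_conj {n : ℕ} (I : Set (Sub n 2)) (γ : Braid n) (x : PZ n) :
    pairChar I (MulAut.conjNormal (QuotientGroup.mk' (level n 4) γ)⁻¹ x) =
      pairChar (perm n γ • I) x := by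
  classical
  obtain ⟨β, rfl⟩ := toPZ_surjective n x
  have e : MulAut.conjNormal (QuotientGroup.mk' (level n 4) γ)⁻¹ (toPZ n β) =
      toPZ n ⟨γ⁻¹ * β.1 * γ⁻¹⁻¹, Subgroup.Normal.conj_mem inferInstance _ β.2 _⟩ := by
    ext
    rw [MulAut.conjNormal_apply]
    rfl
  rw [e, pairChar_toPZ, pairChar_toPZ]
  refine Fintype.prod_equiv (MulAction.toPerm (perm n γ)) _ _ fun p => ?_
  have hp : pairDev (γ⁻¹ * β.1 * γ⁻¹⁻¹) p = pairDev β.1 (perm n γ • p) := by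
    rw [pairDev, dev_conj β.2, map_inv, inv_inv]
    refine (pairDev_eq β.2 (by simp) ?_ ?_).symm
    · rw [mem_smul_iff]; simp [emb_mem]
    · rw [mem_smul_iff]; simp [emb_mem]
  simp only [MulAction.toPerm_apply, Set.smul_mem_smul_set_iff, hp]

/-- The complex character of `PZ n` that corresponds to the set `I` of pairs. -/
def pairCharC {n : ℕ} (I : Set (Sub n 2)) : PZ n →* ℂ :=
  (Int.castRingHom ℂ).toMonoidHom.comp ((Units.coeHom ℤ).comp (pairChar I))

theorem pairCharC_apply {n : ℕ} (I : Set (Sub n 2)) (x : PZ n) :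
    pairCharC I x = ((pairChar I x : ℤ) : ℂ) := rfl

theorem pairCharC_injective {n : ℕ} : Function.Injective (pairCharC (n := n)) := by
  intro I J h
  apply pairChar_injective
  ext x
  have := DFunLike.congr_fun h x
  rw [pairCharC_apply, pairCharC_apply] at this
  exact_mod_cast this

theorem conjChar_pairCharC {n : ℕ} (I : Set (Sub n 2)) (γ : Braid n) :
    Representation.conjChar (pairCharC I) (QuotientGroup.mk' (level n 4) γ) =
      pairCharC (perm n γ • I) := by
  ext x
  rw [Representation.conjChar_apply, pairCharC_apply, pairCharC_apply, pairChar_conj]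

/-- The group `stabZ n I` is the stabilizer of the character of `I`. -/
theorem mem_stabZ_iff {n : ℕ} (I : Set (Sub n 2)) (g : Z n) :
    g ∈ stabZ n I ↔ Representation.conjChar (pairCharC I) g = pairCharC I := by
  obtain ⟨γ, rfl⟩ := QuotientGroup.mk'_surjective _ g
  rw [conjChar_pairCharC, pairCharC_injective.eq_iff]
  constructor
  · rintro ⟨γ', hγ', e⟩
    have : perm n γ' = perm n γ := by
      have h := ((mem_level_iff _).1 (QuotientGroup.eq.1 e)).1
      rw [map_mul, map_inv, inv_mul_eq_one] at h
      exact h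
    rw [← this]
    exact mem_stabB.1 hγ'
  · intro h
    exact ⟨γ, mem_stabB.2 h, rfl⟩

theorem PZ_le_stabZ {n : ℕ} (I : Set (Sub n 2)) : PZ n ≤ stabZ n I :=
  Subgroup.map_mono fun β hβ => by
    rw [mem_stabB, mem_pureBraid.1 hβ, one_smul]

/-- A finite set of commuting involutions has a common eigenvector. -/
theorem exists_common_eigenvector {ι U : Type*} [AddCommGroup U] [Module ℂ U] [Nontrivial U]
    (T : ι → U →ₗ[ℂ] U) (h2 : ∀ i v, T i (T i v) = v) (hc : ∀ i j v, T i (T j v) = T j (T i v))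
    (s : Finset ι) : ∃ v ≠ 0, ∀ i ∈ s, T i v = v ∨ T i v = -v := by
  classical
  induction s using Finset.induction with
  | empty =>
    obtain ⟨v, hv⟩ := exists_ne (0 : U)
    exact ⟨v, hv, by simp⟩
  | insert j s _ ih =>
    obtain ⟨v, hv, h⟩ := ih
    by_cases h0 : v + T j v = 0
    · refine ⟨v, hv, fun i hi => ?_⟩
      rcases Finset.mem_insert.1 hi with rfl | hi
      · exact Or.inr (eq_neg_of_add_eq_zero_right h0)
      · exact h i hi
    · refine ⟨_, h0, fun i hi => ?_⟩
      rcases Finset.mem_insert.1 hi with rfl | hi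
      · left
        rw [map_add, h2, add_comm]
      · rw [map_add, hc]
        rcases h i hi with e | e
        · left; rw [e]
        · right; rw [e, map_neg, neg_add]

/-- In every nonzero representation of `Z n` the character of some set of pairs occurs, since `PZ n`
acts by commuting involutions. -/
theorem exists_mem_charSpace {n : ℕ} {U : Type*} [AddCommGroup U] [Module ℂ U] [Nontrivial U]
    (ρ : Representation ℂ (Z n) U) :
    ∃ (I : Set (Sub n 2)) (v : U), v ≠ 0 ∧ v ∈ Representation.charSpace ρ (pairCharC I) := by
  classical
  have := Fintype.ofFinite (PZ n)
  obtain ⟨v, hv, h⟩ := exists_common_eigenvector (fun x : PZ n => ρ x)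
    (fun x v => by
      rw [← Module.End.mul_apply, ← map_mul, ← Subgroup.coe_mul, PZ_mul_self, Subgroup.coe_one,
        map_one, Module.End.one_apply])
    (fun x y v => by
      rw [← Module.End.mul_apply, ← Module.End.mul_apply, ← map_mul, ← map_mul, ← Subgroup.coe_mul,
        PZ_mul_comm, Subgroup.coe_mul]) Finset.univ
  let I : Set (Sub n 2) := {p | ∀ i d (h : i + d + 1 < n),
    p.1 = {(⟨i, by omega⟩ : Fin n), ⟨i + d + 1, h⟩} → ρ (artinZ n i d) v = -v}
  refine ⟨I, v, hv, ?_⟩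
  have hE : ∀ x ∈ Subgroup.closure {x | ∃ i d, i + d + 1 < n ∧ x = artinZ n i d},
      ρ (x : PZ n) v = pairCharC I x • v := by
    intro x hx
    induction hx using Subgroup.closure_induction with
    | mem x hx =>
      obtain ⟨i, d, hid, rfl⟩ := hx
      have hne : (⟨i, by omega⟩ : Fin n) ≠ ⟨i + d + 1, hid⟩ := by simp [Fin.ext_iff]; omega
      rw [pairCharC_apply, pairChar_artinZ I i d hid (pair _ _ hne) rfl]
      split_ifs with hp
      · rw [hp i d hid rfl]; simp
      · rcases h (artinZ n i d) (Finset.mem_univ _) with e | e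
        · simp [e]
        · refine absurd (fun i' d' h' hp' => ?_) hp
          have : i' = i ∧ d' = d := by
            have h0 : (⟨i, by omega⟩ : Fin n) ∈ (pair _ _ hne).1 := by simp [pair]
            have h1 : (⟨i + d + 1, hid⟩ : Fin n) ∈ (pair _ _ hne).1 := by simp [pair]
            rw [hp'] at h0 h1
            simp only [Finset.mem_insert, Finset.mem_singleton, Fin.ext_iff] at h0 h1
            omega
          rw [this.1, this.2]
          exact e
    | one => simp
    | mul x y _ _ hx hy =>
      rw [Subgroup.coe_mul, map_mul, Module.End.mul_apply, hy, map_smul, hx, smul_smul, map_mul,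
        mul_comm]
    | inv x _ hx =>
      have : x⁻¹ = x := inv_eq_of_mul_eq_one_left (PZ_mul_self x)
      rw [this, hx]
  intro x
  exact hE x (closure_artinZ n ▸ Subgroup.mem_top x)

end

end BraidRep

/-! ### Forgetting strands, and orbits of sets of pairs -/

namespace BraidRep

noncomputable section

theorem perm_inv_apply_self {α : Type*} (g : Equiv.Perm α) (x : α) : g⁻¹ (g x) = x :=
  g.symm_apply_apply x

theorem perm_apply_inv_self {α : Type*} (g : Equiv.Perm α) (x : α) : g (g⁻¹ x) = x :=
  g.apply_symm_apply x

theorem perm_surjective (n : ℕ) : Function.Surjective (perm n) := by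
  rw [← MonoidHom.range_eq_top, eq_top_iff]
  rintro g -
  cases n with
  | zero => exact ⟨1, Subsingleton.elim _ _⟩
  | succ n =>
    have hg : g ∈ Submonoid.closure
        (Set.range fun i : Fin n => Equiv.swap i.castSucc i.succ) := by
      rw [Equiv.Perm.mclosure_swap_castSucc_succ]; trivial
    refine (Submonoid.closure_le (S := (perm (n + 1)).range.toSubmonoid)).2 ?_ hg
    rintro _ ⟨i, rfl⟩
    exact ⟨_, perm_of (n + 1) (show Fin (n + 1 - 1) from i)⟩

section Forget

variable {m n : ℕ} (h : m ≤ n)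

theorem mem_lastPos (x : Fin n) : x ∈ (lastPos h).1 ↔ m ≤ (x : ℕ) := by
  rw [lastPos, Finset.mem_compl, mem_firstPos, not_lt]

theorem emb_lastPos (k : Fin (n - m)) : emb (lastPos h) k = ⟨m + k, by omega⟩ :=
  emb_unique _ (fun k : Fin (n - m) => (⟨m + k, by omega⟩ : Fin n))
    (fun j => by
      rw [mem_lastPos]
      exact Nat.le_add_right m j)
    (fun _ _ hab => Nat.add_lt_add_left hab m) k

/-- The braids whose permutation preserves the set of the first `m` positions. -/
def splitBraid : Subgroup (Braid n) := (MulAction.stabilizer _ (firstPos h)).comap (perm n)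

theorem smul_lastPos {g : Equiv.Perm (Fin n)} (hg : g • firstPos h = firstPos h) :
    g • lastPos h = lastPos h := by
  apply Subtype.ext
  ext x
  have := congrArg (fun A => x ∈ A.1) hg
  simp only [mem_smul_iff, eq_iff_iff] at this
  rw [mem_smul_iff]
  simp only [lastPos, Finset.mem_compl, this]

/-- The two forgetful maps, on all braids that do not mix the first `m` strands with the others. -/
def splitHom : splitBraid h →* Braid m × Braid (n - m) where
  toFun β := (forget β.1 (firstPos h), forget β.1 (lastPos h))
  map_one' := by rw [Subgroup.coe_one, forget_one, forget_one]; rfl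
  map_mul' β γ := by
    have e1 : (perm n β.1)⁻¹ • firstPos h = firstPos h := by
      rw [inv_smul_eq_iff]; exact (show perm n β.1 • firstPos h = firstPos h from β.2).symm
    rw [Subgroup.coe_mul, forget_mul, forget_mul, e1, smul_lastPos h e1]
    rfl

theorem rank_lastPos (x : Fin n) (hx : m ≤ (x : ℕ)) : rank (lastPos h) x = x - m := by
  have hm : x ∈ (lastPos h).1 := by
    rw [lastPos, Finset.mem_compl, mem_firstPos]; omega
  have := (emb_eq_iff (lastPos h) hm ⟨x - m, by omega⟩).1 (by
    rw [emb_lastPos]; ext; simp only; omega)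
  exact this.symm

theorem rank_firstPos (x : Fin n) (hx : (x : ℕ) < m) : rank (firstPos h) x = x := by
  have := (emb_eq_iff (firstPos h) ((mem_firstPos h x).2 hx) ⟨x, hx⟩).1 (by
    rw [emb_firstPos]; ext; rfl)
  exact this.symm

theorem of_mem_splitBraid (i : Fin (n - 1)) (hi' : (i : ℕ) + 1 ≠ m) :
    (PresentedGroup.of i : Braid n) ∈ splitBraid h := by
  change perm n (PresentedGroup.of i) • firstPos h = firstPos h
  rw [perm_of]
  apply Subtype.ext
  ext x
  rw [mem_smul_iff, Equiv.swap_inv, mem_firstPos, mem_firstPos, Equiv.swap_apply_def]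
  split_ifs with h1 h2
  · rw [h1]; simp only [lo, hi]; omega
  · rw [h2]; simp only [lo, hi]; omega
  · rfl

/-- The image of the splitting homomorphism contains the half-twists of both factors: they are the
images of the half-twists on the first `m` and on the last `n - m` strands. -/
theorem splitHom_surjective : Function.Surjective (splitHom h) := by
  have h1 : ∀ α : Braid m, (α, 1) ∈ (splitHom h).range := by
    intro α
    refine Braid.induction (fun α => (α, 1) ∈ (splitHom h).range) (one_mem _) ?_ ?_ ?_ α
    · intro i
      let j : Fin (n - 1) := ⟨i, by omega⟩
      have hj : (j : ℕ) + 1 ≠ m := by have := i.2; simp only [j]; omega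
      refine ⟨⟨PresentedGroup.of j, of_mem_splitBraid h j hj⟩, Prod.ext ?_ ?_⟩
      · change forget (PresentedGroup.of j) (firstPos h) = PresentedGroup.of i
        have hl : lo j ∈ (firstPos h).1 := (mem_firstPos h _).2 (by simp only [lo, j]; omega)
        have hh : hi j ∈ (firstPos h).1 := (mem_firstPos h _).2 (by simp only [hi, j]; omega)
        rw [forget_of, forgetGen, if_pos ⟨hl, hh⟩, rank_firstPos h _ ((mem_firstPos h _).1 hl)]
        exact σ_fin i
      · change forget (PresentedGroup.of j) (lastPos h) = 1
        rw [forget_of, forgetGen, if_neg]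
        rw [mem_lastPos, mem_lastPos]
        simp only [lo, j]; omega
    · intro x y hx hy
      have := mul_mem hx hy
      rwa [Prod.mk_mul_mk, one_mul] at this
    · intro x hx
      have := inv_mem hx
      rwa [Prod.inv_mk, inv_one] at this
  have h2 : ∀ α : Braid (n - m), (1, α) ∈ (splitHom h).range := by
    intro α
    refine Braid.induction (fun α => (1, α) ∈ (splitHom h).range) (one_mem _) ?_ ?_ ?_ α
    · intro i
      let j : Fin (n - 1) := ⟨m + i, by omega⟩
      have hj : (j : ℕ) + 1 ≠ m := by simp only [j]; omega
      refine ⟨⟨PresentedGroup.of j, of_mem_splitBraid h j hj⟩, Prod.ext ?_ ?_⟩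
      · change forget (PresentedGroup.of j) (firstPos h) = 1
        rw [forget_of, forgetGen, if_neg]
        rw [mem_firstPos, mem_firstPos]
        simp only [lo, j]; omega
      · change forget (PresentedGroup.of j) (lastPos h) = PresentedGroup.of i
        have hl : lo j ∈ (lastPos h).1 := (mem_lastPos h _).2 (by simp only [lo, j]; omega)
        have hh : hi j ∈ (lastPos h).1 := (mem_lastPos h _).2 (by simp only [hi, j]; omega)
        rw [forget_of, forgetGen, if_pos ⟨hl, hh⟩, rank_lastPos h _ ((mem_lastPos h _).1 hl),
          ← σ_fin i]
        congr 1
        simp [lo, j]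
    · intro x y hx hy
      have := mul_mem hx hy
      rwa [Prod.mk_mul_mk, one_mul] at this
    · intro x hx
      have := inv_mem hx
      rwa [Prod.inv_mk, inv_one] at this
  rintro ⟨α, γ⟩
  have := mul_mem (h1 α) (h2 γ)
  rwa [Prod.mk_mul_mk, one_mul, mul_one] at this

theorem perm_castLE {β : Braid n} (hβ : β ∈ splitBraid h) (k : Fin m) :
    perm n β (Fin.castLE h k) = Fin.castLE h (perm m (forget β (firstPos h)) k) := by
  have := perm_forget β (firstPos h) k
  have e1 : (perm n β)⁻¹ • firstPos h = firstPos h := by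
    rw [inv_smul_eq_iff]; exact (show perm n β • firstPos h = firstPos h from hβ).symm
  rw [e1, emb_firstPos, emb_firstPos] at this
  exact this.symm

theorem perm_eq_one {β : Braid n} (hβ : β ∈ splitBraid h)
    (h1 : perm m (forget β (firstPos h)) = 1) (h2 : perm (n - m) (forget β (lastPos h)) = 1) :
    perm n β = 1 := by
  have e1 : (perm n β)⁻¹ • firstPos h = firstPos h := by
    rw [inv_smul_eq_iff]; exact (show perm n β • firstPos h = firstPos h from hβ).symm
  ext1 x
  rw [Equiv.Perm.one_apply]
  by_cases hx : (x : ℕ) < m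
  · obtain ⟨k, rfl⟩ := exists_emb _ ((mem_firstPos h x).2 hx)
    have := perm_forget β (firstPos h) k
    rw [h1, e1] at this
    exact this.symm
  · obtain ⟨k, rfl⟩ := exists_emb _ ((mem_lastPos h x).2 (not_lt.1 hx))
    have := perm_forget β (lastPos h) k
    rw [h2, smul_lastPos h e1] at this
    exact this.symm

/-- The embedding of the pairs of positions. -/
abbrev embPair : Sub m 2 → Sub n 2 := Set.powersetCard.map 2 (Fin.castLEEmb h)

theorem embPair_injective : Function.Injective (embPair h) := fun _ _ hpq =>
  Subtype.ext (Finset.map_injective _ (congrArg Subtype.val hpq))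

theorem mem_embPair (p : Sub m 2) (x : Fin n) :
    x ∈ (embPair h p).1 ↔ ∃ k ∈ p.1, Fin.castLE h k = x := by
  change x ∈ p.1.map _ ↔ _
  rw [Finset.mem_map]
  rfl

theorem smul_embPair {g : Equiv.Perm (Fin n)} {g' : Equiv.Perm (Fin m)}
    (hg : ∀ k, g (Fin.castLE h k) = Fin.castLE h (g' k)) (p : Sub m 2) :
    g • embPair h p = embPair h (g' • p) := by
  apply Subtype.ext
  ext x
  rw [mem_smul_iff, mem_embPair, mem_embPair]
  constructor
  · rintro ⟨k, hk, e⟩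
    refine ⟨g' k, by rw [mem_smul_iff, perm_inv_apply_self]; exact hk, ?_⟩
    rw [← hg, e, perm_apply_inv_self]
  · rintro ⟨k, hk, rfl⟩
    rw [mem_smul_iff] at hk
    refine ⟨_, hk, ?_⟩
    rw [Equiv.Perm.eq_inv_iff_eq, hg, perm_apply_inv_self]

theorem smul_extend {g : Equiv.Perm (Fin n)} {g' : Equiv.Perm (Fin m)}
    (hg : ∀ k, g (Fin.castLE h k) = Fin.castLE h (g' k)) (I : Set (Sub m 2)) :
    g • extend h I = extend h (g' • I) := by
  ext p
  constructor
  · rintro ⟨_, ⟨q, hq, rfl⟩, rfl⟩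
    exact ⟨g' • q, Set.smul_mem_smul_set hq, (smul_embPair h hg q).symm⟩
  · rintro ⟨_, ⟨q, hq, rfl⟩, rfl⟩
    exact ⟨_, ⟨q, hq, rfl⟩, smul_embPair h hg q⟩

theorem extend_injective : Function.Injective (extend (m := m) (n := n) h) :=
  (embPair_injective h).image_injective

theorem stabB_le_splitBraid {I : Set (Sub m 2)} (hI : IsFull I) :
    stabB n (extend h I) ≤ splitBraid h := fun _ hβ => stab_firstPos h hI (mem_stabB.1 hβ)

theorem pairDev_forget (β : Braid n) (q : Sub m 2) :
    pairDev (forget β (firstPos h)) q = pairDev β (embPair h q) := by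
  have e : ∀ j, emb (embPair h q) j = emb (firstPos h) (emb q j) := fun j =>
    emb_unique _ (fun j => emb (firstPos h) (emb q j))
      (fun j => by
        rw [mem_embPair]
        exact ⟨emb q j, emb_mem q j, (emb_firstPos h _).symm⟩)
      ((emb (firstPos h)).strictMono.comp (emb q).strictMono) j
  rw [pairDev, pairDev, dev_forget _ _ _ _ (emb_zero_ne_one q), e, e]

theorem mk_mem_PZ {β : Braid n} :
    QuotientGroup.mk' (level n 4) β ∈ PZ n ↔ perm n β = 1 := by
  constructor
  · rintro ⟨γ, hγ, e⟩
    have h := ((mem_level_iff _).1 (QuotientGroup.eq.1 e)).1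
    rw [map_mul, map_inv, mem_pureBraid.1 hγ, inv_one, one_mul] at h
    exact h
  · intro hβ
    exact ⟨β, hβ, rfl⟩

variable {I : Set (Sub m 2)} (hI : IsFull I)

theorem proj_surjective : Function.Surjective (proj h hI) := by
  rintro ⟨a, b⟩
  obtain ⟨⟨α, hα⟩, rfl⟩ := toStabZ_surjective m I a
  obtain ⟨γ, rfl⟩ := perm_surjective (n - m) b
  obtain ⟨⟨β, hβ⟩, e⟩ := splitHom_surjective h (α, γ)
  have e1 : forget β (firstPos h) = α := congrArg Prod.fst e
  have e2 : forget β (lastPos h) = γ := congrArg Prod.snd e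
  have hs : β ∈ stabB n (extend h I) := by
    rw [mem_stabB, smul_extend h (perm_castLE h hβ), e1, mem_stabB.1 hα]
  refine ⟨toStabZ _ _ ⟨β, hs⟩, ?_⟩
  rw [proj_toStabZ]
  exact Prod.ext (congrArg (toStabZ m I) (Subtype.ext e1)) (congrArg (perm (n - m)) e2)

/-- Under the projection of `Z_n^I` the image of the pure braid group is the preimage of the
image of the pure braid group. -/
theorem proj_mem_PZ_iff (x : stabZ n (extend h I)) :
    (x : Z n) ∈ PZ n ↔ ((proj h hI x).1 : Z m) ∈ PZ m ∧ (proj h hI x).2 = 1 := by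
  obtain ⟨β, rfl⟩ := toStabZ_surjective _ _ x
  rw [proj_toStabZ]
  change QuotientGroup.mk' (level n 4) β.1 ∈ PZ n ↔
    QuotientGroup.mk' (level m 4) (forget β.1 (firstPos h)) ∈ PZ m ∧
      perm (n - m) (forget β.1 (lastPos h)) = 1
  rw [mk_mem_PZ, mk_mem_PZ]
  have hs := stabB_le_splitBraid h hI β.2
  refine ⟨fun hβ => ⟨?_, ?_⟩, fun hβ => perm_eq_one h hs hβ.1 hβ.2⟩
  · ext1 k
    have := perm_forget β.1 (firstPos h) k
    rw [hβ, inv_one, one_smul, Equiv.Perm.one_apply, EmbeddingLike.apply_eq_iff_eq] at this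
    exact this
  · ext1 k
    have := perm_forget β.1 (lastPos h) k
    rw [hβ, inv_one, one_smul, Equiv.Perm.one_apply, EmbeddingLike.apply_eq_iff_eq] at this
    exact this

/-- The character of `extend h I` is the pullback along `proj` of the character of `I`. -/
theorem pairChar_proj (x : stabZ n (extend h I)) (hx : (x : Z n) ∈ PZ n)
    (hx' : ((proj h hI x).1 : Z m) ∈ PZ m) :
    pairChar I ⟨(proj h hI x).1, hx'⟩ = pairChar (extend h I) ⟨x, hx⟩ := by
  classical
  obtain ⟨β, rfl⟩ := toStabZ_surjective _ _ x
  have hβ : β.1 ∈ pureBraid n := mk_mem_PZ.1 hx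
  have e := proj_toStabZ h hI β
  have hx'' : (toStabZ m I (forgetLast h hI β) : Z m) ∈ PZ m := by rw [e] at hx'; exact hx'
  have hβ' : forget β.1 (firstPos h) ∈ pureBraid m := mk_mem_PZ.1 hx''
  have e1 : (⟨(proj h hI (toStabZ _ _ β)).1, hx'⟩ : PZ m) = toPZ m ⟨_, hβ'⟩ := by
    apply Subtype.ext
    simp only [e]
    rfl
  have e2 : (⟨toStabZ _ _ β, hx⟩ : PZ n) = toPZ n ⟨_, hβ⟩ := rfl
  rw [e1, e2, pairChar_toPZ, pairChar_toPZ]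
  refine Fintype.prod_of_injective (embPair h) (embPair_injective h) _ _ ?_ ?_
  · intro p hp
    rw [if_neg]
    rintro ⟨q, -, rfl⟩
    exact hp ⟨q, rfl⟩
  · intro q
    simp only [pairDev_forget, extend, (embPair_injective h).mem_set_image]

end Forget

section Orbits

variable {n : ℕ}

theorem exists_perm_castLE {m : ℕ} (h : m ≤ n) (g' : Equiv.Perm (Fin m)) :
    ∃ g : Equiv.Perm (Fin n), ∀ k, g (Fin.castLE h k) = Fin.castLE h (g' k) :=
  ⟨g'.viaFintypeEmbedding (Fin.castLEEmb h), fun k =>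
    g'.viaFintypeEmbedding_apply_image (Fin.castLEEmb h) k⟩

/-- Every set of pairs is a translate of a full set of pairs of the first `m` positions, where `m` is
the size of the union of the pairs. -/
theorem exists_smul_extend_eq (J : Set (Sub n 2)) :
    ∃ (m : ℕ) (h : m ≤ n) (I : Set (Sub m 2)) (g : Equiv.Perm (Fin n)),
      IsFull I ∧ g • extend h I = J := by
  classical
  let s : Finset (Fin n) := Finset.univ.filter fun x => ∃ p ∈ J, x ∈ p.1
  have hs : ∀ x, x ∈ s ↔ ∃ p ∈ J, x ∈ p.1 := fun x => by simp [s]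
  have h : s.card ≤ n := by simpa using s.card_le_univ
  have : MulAction.IsPretransitive (Equiv.Perm (Fin n)) (Sub n s.card) :=
    Set.powersetCard.isPretransitive
  obtain ⟨g, hg⟩ := MulAction.exists_smul_eq (Equiv.Perm (Fin n)) (firstPos h)
    (⟨s, rfl⟩ : Sub n s.card)
  have hmem : ∀ x, g x ∈ s ↔ (x : ℕ) < s.card := fun x => by
    have e := congrArg (fun A : Sub n s.card => g x ∈ A.1) hg
    rw [← mem_firstPos h]
    simpa only [mem_smul_iff, perm_inv_apply_self, eq_iff_iff] using e.symm
  have hJ : ∀ p ∈ J, ∃ q : Sub s.card 2, g • embPair h q = p := by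
    intro p hp
    have hlt : ∀ j, ((g⁻¹ (emb p j) : Fin n) : ℕ) < s.card := fun j => by
      rw [← hmem, perm_apply_inv_self, hs]
      exact ⟨p, hp, emb_mem p j⟩
    let e : Fin 2 → Fin s.card := fun j => ⟨g⁻¹ (emb p j), hlt j⟩
    have hne : e 0 ≠ e 1 := fun he => emb_zero_ne_one p
      (g⁻¹.injective (Fin.ext (Fin.mk.inj_iff.1 he)))
    refine ⟨pair (e 0) (e 1) hne, Subtype.ext ?_⟩
    ext x
    rw [mem_smul_iff, mem_embPair, sub_two_eq p]
    simp only [pair, Finset.mem_insert, Finset.mem_singleton, exists_eq_or_imp, exists_eq_left]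
    have he : ∀ j, Fin.castLE h (e j) = g⁻¹ (emb p j) := fun j => rfl
    rw [he, he, EmbeddingLike.apply_eq_iff_eq, EmbeddingLike.apply_eq_iff_eq, eq_comm,
      eq_comm (a := emb p 1)]
  refine ⟨s.card, h, {q | g • embPair h q ∈ J}, g, ?_, ?_⟩
  · intro x
    have hx : g (Fin.castLE h x) ∈ s := (hmem _).2 x.2
    obtain ⟨p, hp, hxp⟩ := (hs _).1 hx
    obtain ⟨q, rfl⟩ := hJ p hp
    refine ⟨q, hp, ?_⟩
    rw [mem_smul_iff, perm_inv_apply_self, mem_embPair] at hxp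
    obtain ⟨k, hk, e⟩ := hxp
    have : k = x := Fin.ext (by simpa [Fin.ext_iff] using e)
    exact this ▸ hk
  · ext p
    constructor
    · rintro ⟨_, ⟨q, hq, rfl⟩, rfl⟩
      exact hq
    · intro hp
      obtain ⟨q, rfl⟩ := hJ p hp
      exact ⟨_, ⟨q, hp, rfl⟩, rfl⟩

theorem smul_firstPos_eq {m m' : ℕ} (h : m ≤ n) (h' : m' ≤ n) {I : Set (Sub m 2)}
    {I' : Set (Sub m' 2)} (hI : IsFull I) (hI' : IsFull I') {g : Equiv.Perm (Fin n)}
    (hg : g • extend h I = extend h' I') (x : Fin n) :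
    g x ∈ (firstPos h').1 ↔ x ∈ (firstPos h).1 := by
  rw [mem_firstPos_iff h' hI', mem_firstPos_iff h hI, ← hg]
  constructor
  · rintro ⟨_, ⟨p, hp, rfl⟩, hx⟩
    refine ⟨p, hp, ?_⟩
    change g x ∈ (g • p).1 at hx
    rwa [mem_smul_iff, perm_inv_apply_self] at hx
  · rintro ⟨p, hp, hx⟩
    refine ⟨g • p, Set.smul_mem_smul_set hp, ?_⟩
    rwa [mem_smul_iff, perm_inv_apply_self]

theorem eq_of_smul_extend_eq {m m' : ℕ} (h : m ≤ n) (h' : m' ≤ n) {I : Set (Sub m 2)}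
    {I' : Set (Sub m' 2)} (hI : IsFull I) (hI' : IsFull I') {g : Equiv.Perm (Fin n)}
    (hg : g • extend h I = extend h' I') : m = m' := by
  have : (firstPos h).1.map g.toEmbedding = (firstPos h').1 := by
    ext x
    rw [Finset.mem_map_equiv, ← smul_firstPos_eq h h' hI hI' hg, Equiv.apply_symm_apply]
  have := congrArg Finset.card this
  rw [Finset.card_map] at this
  exact (firstPos h).2.symm.trans (this.trans (firstPos h').2)

theorem exists_smul_eq_of_smul_extend_eq {m : ℕ} (h : m ≤ n) {I I' : Set (Sub m 2)}
    (hI : IsFull I) (hI' : IsFull I') {g : Equiv.Perm (Fin n)}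
    (hg : g • extend h I = extend h I') : ∃ g' : Equiv.Perm (Fin m), g' • I = I' := by
  obtain ⟨β, rfl⟩ := perm_surjective n g
  have hβ : β ∈ splitBraid h := by
    change perm n β • firstPos h = firstPos h
    apply Subtype.ext
    ext x
    rw [mem_smul_iff, ← smul_firstPos_eq h h hI hI' hg, perm_apply_inv_self]
  rw [smul_extend h (perm_castLE h hβ)] at hg
  exact ⟨_, extend_injective h hg⟩

end Orbits

end

end BraidRep

/-! ### The representations `V_n(ρ, λ)` -/

namespace BraidRep

noncomputable section

section Induced

open Representation

variable {m n : ℕ} (h : m ≤ n) {I : Set (Sub m 2)} (hI : IsFull I)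

/-- The representation `ρ ⊠ λ` of `Z_n^I` from which `V_n(ρ, λ)` is induced. -/
abbrev boxRep (ρ : Rep.{u} ℂ (stabZ m I)) (lam : Rep.{u} ℂ (Equiv.Perm (Fin (n - m)))) :
    Representation ℂ (stabZ n (extend h I)) (ρ ⊗[ℂ] lam) :=
  Representation.tprod (ρ.ρ.comp ((MonoidHom.fst _ _).comp (proj h hI)))
    (lam.ρ.comp ((MonoidHom.snd _ _).comp (proj h hI)))

theorem exists_proj_eq (a : stabZ m I) (b : Equiv.Perm (Fin (n - m))) :
    ∃ x, ((MonoidHom.fst _ _).comp (proj h hI)) x = a ∧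
      ((MonoidHom.snd _ _).comp (proj h hI)) x = b := by
  obtain ⟨x, hx⟩ := proj_surjective h hI (a, b)
  exact ⟨x, congrArg Prod.fst hx, congrArg Prod.snd hx⟩

theorem boxRep_apply_of_mem_PZ {ρ : Rep.{u} ℂ (stabZ m I)}
    (lam : Rep.{u} ℂ (Equiv.Perm (Fin (n - m)))) (hρ : IsIsotypic I ρ)
    (x : PZ n) (w : ρ ⊗[ℂ] lam) :
    boxRep h hI ρ lam ⟨x, PZ_le_stabZ _ x.2⟩ w = pairCharC (extend h I) x • w := by
  obtain ⟨χ, hχ, hact⟩ := hρ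
  obtain rfl := hχ.eq_pairChar
  set y : stabZ n (extend h I) := ⟨x, PZ_le_stabZ _ x.2⟩ with hy
  obtain ⟨h1, h2⟩ := (proj_mem_PZ_iff h hI y).1 x.2
  have e : ρ.ρ (proj h hI y).1 = pairCharC (extend h I) x • LinearMap.id := by
    ext v
    rw [hact _ h1 v, pairChar_proj h hI y x.2 h1]
    rfl
  have : boxRep h hI ρ lam y = pairCharC (extend h I) x • LinearMap.id := by
    ext v w
    change ρ.ρ (proj h hI y).1 v ⊗ₜ lam.ρ (proj h hI y).2 w = _
    rw [e, h2, map_one]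
    simp [TensorProduct.smul_tmul']
  rw [this]
  simp

theorem isCliffordInduced_inducedRep {ρ : Rep.{u} ℂ (stabZ m I)}
    (lam : Rep.{u} ℂ (Equiv.Perm (Fin (n - m)))) (hρ : IsIsotypic I ρ) :
    IsCliffordInduced (pairCharC (extend h I)) (boxRep h hI ρ lam) (inducedRep h hI ρ lam).ρ
      (IndV.mk (stabZ n (extend h I)).subtype (boxRep h hI ρ lam) 1) :=
  isCliffordInduced_ind _ _ (fun x => PZ_le_stabZ _ x.2) (boxRep_apply_of_mem_PZ h hI lam hρ)
    (mem_stabZ_iff _)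

theorem boxRep_irreducible {ρ : Rep.{u} ℂ (stabZ m I)}
    {lam : Rep.{u} ℂ (Equiv.Perm (Fin (n - m)))} (hρ : ρ.ρ.IsIrreducible)
    (hl : lam.ρ.IsIrreducible) : (boxRep h hI ρ lam).IsIrreducible :=
  have := hρ.finiteDimensional
  hρ.tprod_comp hl _ _ (exists_proj_eq h hI)

theorem inducedRep_irreducible {ρ : Rep.{u} ℂ (stabZ m I)}
    {lam : Rep.{u} ℂ (Equiv.Perm (Fin (n - m)))} (hρ : ρ.ρ.IsIrreducible) (hi : IsIsotypic I ρ)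
    (hl : lam.ρ.IsIrreducible) : (inducedRep h hI ρ lam).ρ.IsIrreducible :=
  (isCliffordInduced_inducedRep h hI lam hi).isIrreducible (boxRep_irreducible h hI hρ hl)

theorem RepIso.symm {G : Type} [Group G] {V W : Rep.{u} ℂ G} (e : RepIso V W) : RepIso W V :=
  ⟨e.some.symm⟩

theorem RepIso.trans {G : Type} [Group G] {V W X : Rep.{u} ℂ G} (e : RepIso V W)
    (f : RepIso W X) : RepIso V X := ⟨e.some.trans f.some⟩

/-- An irreducible representation of `Z n` in which the character of `extend h I` occurs receives
a nonzero map from some `ρ ⊠ λ`, hence is isomorphic to `V_n(ρ, λ)`. -/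
theorem exists_repIso_inducedRep {U : Rep.{u} ℂ (Z n)} (hU : U.ρ.IsIrreducible) {v : U}
    (hv : v ∈ charSpace U.ρ (pairCharC (extend h I))) (hv0 : v ≠ 0) :
    ∃ (ρ : Rep.{u} ℂ (stabZ m I)) (lam : Rep.{u} ℂ (Equiv.Perm (Fin (n - m)))),
      ρ.ρ.IsIrreducible ∧ IsIsotypic I ρ ∧ lam.ρ.IsIrreducible ∧
      ∀ (ρ' : Rep.{u} ℂ (stabZ m I)) (lam' : Rep.{u} ℂ (Equiv.Perm (Fin (n - m)))),
        ρ'.ρ.IsIrreducible → IsIsotypic I ρ' → lam'.ρ.IsIrreducible → RepIso ρ ρ' →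
        RepIso lam lam' → RepIso U (inducedRep h hI ρ' lam') := by
  let X : Subrepresentation (U.ρ.comp (stabZ n (extend h I)).subtype) :=
    ⟨charSpace U.ρ (pairCharC (extend h I)), fun g w hw => by
      have := apply_mem_charSpace hw (g : Z n)
      rwa [(mem_stabZ_iff _ _).1 g.2] at this⟩
  have : Nontrivial X.toSubmodule := ⟨⟨v, hv⟩, 0, fun e => hv0 (congrArg Subtype.val e)⟩
  have hX : ∀ (g : stabZ n (extend h I)) (hg : (g : Z n) ∈ PZ n) (w : X.toSubmodule),
      X.toRepresentation g w = pairCharC (extend h I) ⟨g, hg⟩ • w := fun g hg w =>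
    Subtype.ext (w.2 ⟨g, hg⟩)
  obtain ⟨ρ, lam, i, hρ, hl, hi, hiX, F, x, hx⟩ := exists_tprod_comp_map X.toRepresentation
    ((MonoidHom.fst _ _).comp (proj h hI)) ((MonoidHom.snd _ _).comp (proj h hI))
    (exists_proj_eq h hI) (fun g h1 h2 => by
      have h1 : (proj h hI g).1 = 1 := h1
      have h2 : (proj h hI g).2 = 1 := h2
      have hm : ((proj h hI g).1 : Z m) ∈ PZ m := by rw [h1]; exact one_mem _
      have hg : (g : Z n) ∈ PZ n := (proj_mem_PZ_iff h hI g).2 ⟨hm, h2⟩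
      have e : (⟨(proj h hI g).1, hm⟩ : PZ m) = 1 := by
        apply Subtype.ext
        change ((proj h hI g).1 : Z m) = 1
        rw [h1]; rfl
      ext w : 1
      rw [hX g hg, pairCharC_apply, ← pairChar_proj h hI g hg hm, e, map_one]
      simp)
  refine ⟨ρ, lam, hρ, ⟨pairChar I, isPairCharacter_pairChar I, ?_⟩, hl, ?_⟩
  · intro g hg w
    obtain ⟨y, rfl, hy⟩ := exists_proj_eq h hI g 1
    have hyP : (y : Z n) ∈ PZ n := (proj_mem_PZ_iff h hI y).2 ⟨hg, hy⟩
    apply hi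
    rw [hiX y hy w, hX y hyP, pairCharC_apply, ← pairChar_proj h hI y hyP hg, map_smul]
    rfl
  · rintro ρ' lam' hρ' hi' hl' ⟨e1⟩ ⟨e2⟩
    let T : ρ' ⊗[ℂ] lam' ≃ₗ[ℂ] ρ ⊗[ℂ] lam :=
      TensorProduct.congr e1.symm.toLinearEquiv e2.symm.toLinearEquiv
    have he1 : ∀ a w, e1.symm (ρ'.ρ a w) = ρ.ρ a (e1.symm w) := fun a w =>
      IntertwiningMap.isIntertwining _ _ e1.symm.toIntertwiningMap a w
    have he2 : ∀ a w, e2.symm (lam'.ρ a w) = lam.ρ a (e2.symm w) := fun a w =>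
      IntertwiningMap.isIntertwining _ _ e2.symm.toIntertwiningMap a w
    have hT : ∀ g w, T (boxRep h hI ρ' lam' g w) = tprod
        (ρ.ρ.comp ((MonoidHom.fst _ _).comp (proj h hI)))
        (lam.ρ.comp ((MonoidHom.snd _ _).comp (proj h hI))) g (T w) := by
      intro g w
      induction w using TensorProduct.induction_on with
      | zero => simp only [map_zero]
      | add a b ha hb => simp only [map_add, ha, hb]
      | tmul a b =>
        change e1.symm (ρ'.ρ _ a) ⊗ₜ e2.symm (lam'.ρ _ b) = ρ.ρ _ (e1.symm a) ⊗ₜ lam.ρ _ (e2.symm b)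
        rw [he1, he2]
    -- Frobenius reciprocity extends `f` to the induced representation
    let f : ρ' ⊗[ℂ] lam' →ₗ[ℂ] U :=
      X.toSubmodule.subtype ∘ₗ F.toLinearMap ∘ₗ T.toLinearMap
    have hf : ∀ g w, f (boxRep h hI ρ' lam' g w) = U.ρ g (f w) := by
      intro g w
      change ((F (T (boxRep h hI ρ' lam' g w)) : X.toSubmodule) : U) = _
      rw [hT, IntertwiningMap.isIntertwining]
      rfl
    have hne : indLift (boxRep h hI ρ' lam') U.ρ f hf
        (IndV.mk (stabZ n (extend h I)).subtype (boxRep h hI ρ' lam') 1 (T.symm x)) ≠ 0 := by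
      rw [indLift_mk_one]
      change ((F (T (T.symm x)) : X.toSubmodule) : U) ≠ 0
      rw [T.apply_symm_apply]
      exact fun e => hx (Subtype.ext e)
    have := (inducedRep_irreducible h hI hρ' hi' hl').nonempty_equiv hU _ _ hne
    exact RepIso.symm this

end Induced

theorem exists_smul_extend_eq_of_isSystemOfReps {n : ℕ} {𝕀 : ∀ m : ℕ, Set (Set (Sub m 2))}
    (h𝕀 : ∀ m : ℕ, IsSystemOfReps (fun I : Set (Sub m 2) => IsFull I)
      (fun I J => ∃ g : Equiv.Perm (Fin m), g • I = J) (𝕀 m)) (J : Set (Sub n 2)) :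
    ∃ (m : ℕ) (h : m ≤ n) (I : Set (Sub m 2)) (g : Equiv.Perm (Fin n)),
      I ∈ 𝕀 m ∧ g • J = extend h I := by
  obtain ⟨m, h, I, g, hI, rfl⟩ := exists_smul_extend_eq J
  obtain ⟨I', ⟨hI', g', rfl⟩, -⟩ := (h𝕀 m).2 I hI
  obtain ⟨k, hk⟩ := exists_perm_castLE h g'
  refine ⟨m, h, g' • I, k * g⁻¹, hI', ?_⟩
  rw [mul_smul, inv_smul_smul, smul_extend h hk]

theorem IsSystemOfReps.eq {α : Type*} {C : α → Prop} {r : α → α → Prop} {R : Set α}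
    (h : IsSystemOfReps C r R) (hr : ∀ x, r x x) {x y : α} (hx : x ∈ R) (hy : y ∈ R)
    (hxy : r x y) : x = y :=
  (h.2 x (h.1 x hx)).unique ⟨hx, hr x⟩ ⟨hy, hxy⟩

end

end BraidRep

open BraidRep Representation in
theorem theorem1p4 (n : ℕ)
    -- a system of representatives of the orbits of `S_m` on full sets of pairs, for each `m`
    (𝕀 : ∀ m : ℕ, Set (Set (BraidRep.Sub m 2)))
    (h𝕀 : ∀ m : ℕ, BraidRep.IsSystemOfReps (fun I : Set (BraidRep.Sub m 2) => BraidRep.IsFull I)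
      (fun I J => ∃ g : Equiv.Perm (Fin m), g • I = J) (𝕀 m))
    -- one representative of each isomorphism class of `I`-isotypic irreducibles of `Z_m^I`
    (R : ∀ (m : ℕ) (I : Set (BraidRep.Sub m 2)), Set (Rep.{u} ℂ (BraidRep.stabZ m I)))
    (hR : ∀ (m : ℕ) (I : Set (BraidRep.Sub m 2)), I ∈ 𝕀 m →
      BraidRep.IsSystemOfReps
        (fun V : Rep.{u} ℂ (BraidRep.stabZ m I) => V.ρ.IsIrreducible ∧ BraidRep.IsIsotypic I V)
        BraidRep.RepIso (R m I))
    -- one representative of each isomorphism class of irreducibles of `S_k`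
    (L : ∀ k : ℕ, Set (Rep.{u} ℂ (Equiv.Perm (Fin k))))
    (hL : ∀ k : ℕ, BraidRep.IsSystemOfReps
      (fun W : Rep.{u} ℂ (Equiv.Perm (Fin k)) => W.ρ.IsIrreducible) BraidRep.RepIso (L k)) :
    (∀ x : BraidRep.Name n 𝕀 R L,
      (BraidRep.inducedRep x.m_le ((h𝕀 x.m).1 x.I x.I_mem) x.ρ x.lam).ρ.IsIrreducible) ∧
    (∀ U : Rep.{u} ℂ (BraidRep.Z n), U.ρ.IsIrreducible →
      ∃! x : BraidRep.Name n 𝕀 R L,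
        BraidRep.RepIso U
          (BraidRep.inducedRep x.m_le ((h𝕀 x.m).1 x.I x.I_mem) x.ρ x.lam)) := by
  refine ⟨fun x => inducedRep_irreducible _ _ ((hR _ _ x.I_mem).1 _ x.ρ_mem).1
    ((hR _ _ x.I_mem).1 _ x.ρ_mem).2 ((hL _).1 _ x.lam_mem), fun U hU => ?_⟩
  have hrefl : ∀ {G : Type} [Group G] (V : Rep.{u} ℂ G), RepIso V V := fun V => ⟨.refl V.ρ⟩
  refine existsUnique_of_exists_of_unique ?_ ?_
  · have := hU.nontrivial
    obtain ⟨J, v, hv0, hv⟩ := exists_mem_charSpace U.ρ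
    obtain ⟨m, h, I, g, hI, hg⟩ := exists_smul_extend_eq_of_isSystemOfReps h𝕀 J
    obtain ⟨γ, rfl⟩ := perm_surjective n g
    -- a translate of `v` is an eigenvector for the character of `extend h I`
    have hw := apply_mem_charSpace hv (QuotientGroup.mk' (level n 4) γ)
    rw [conjChar_pairCharC, hg] at hw
    have hw0 : U.ρ (QuotientGroup.mk' (level n 4) γ) v ≠ 0 := fun e => hv0 (by
      have := congrArg (U.ρ (QuotientGroup.mk' (level n 4) γ)⁻¹) e
      rwa [← Module.End.mul_apply, ← map_mul, inv_mul_cancel, map_one, map_zero] at this)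
    obtain ⟨ρ, lam, hρ, hi, hl, H⟩ := exists_repIso_inducedRep h ((h𝕀 m).1 I hI) hU hw hw0
    obtain ⟨ρ', ⟨hρ', e1⟩, -⟩ := (hR m I hI).2 ρ ⟨hρ, hi⟩
    obtain ⟨lam', ⟨hl', e2⟩, -⟩ := (hL (n - m)).2 lam hl
    obtain ⟨h1, h2⟩ := (hR m I hI).1 ρ' hρ'
    exact ⟨⟨m, h, I, hI, ρ', hρ', lam', hl'⟩, H ρ' lam' h1 h2 ((hL _).1 _ hl') e1 e2⟩
  · rintro ⟨m, h, I, hI, ρ, hρ, lam, hl⟩ ⟨m', h', I', hI', ρ', hρ', lam', hl'⟩ e e'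
    obtain ⟨φ⟩ := e.symm.trans e'
    have fI := (h𝕀 m).1 I hI
    have fI' := (h𝕀 m').1 I' hI'
    obtain ⟨h1, h2⟩ := (hR m I hI).1 ρ hρ
    obtain ⟨h1', h2'⟩ := (hR m' I' hI').1 ρ' hρ'
    have h3 := (hL _).1 _ hl
    have h3' := (hL _).1 _ hl'
    have c := isCliffordInduced_inducedRep h fI lam h2
    have c' := isCliffordInduced_inducedRep h' fI' lam' h2'
    obtain ⟨g, hg⟩ : ∃ g : Equiv.Perm (Fin n), g • extend h I = extend h' I' := by
      have := (boxRep_irreducible h' fI' h1' h3').nontrivial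
      obtain ⟨x, hx⟩ := c.exists_conjChar_eq_of_equiv c' φ
      obtain ⟨γ, rfl⟩ := QuotientGroup.mk'_surjective _ x
      rw [conjChar_pairCharC] at hx
      exact ⟨_, pairCharC_injective hx⟩
    obtain rfl := eq_of_smul_extend_eq h h' fI fI' hg
    obtain rfl := (h𝕀 m).eq (fun I => ⟨1, one_smul _ I⟩) hI hI'
      (exists_smul_eq_of_smul_extend_eq h fI fI' hg)
    obtain ⟨ψ⟩ := c.nonempty_equiv c' φ (boxRep_irreducible h fI h1 h3)
      (boxRep_irreducible h fI h1' h3')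
    obtain rfl := (hR m I hI).eq hrefl hρ hρ'
      (h1.equiv_left_of_tprod_comp h3 h1' _ _ (exists_proj_eq h fI) ψ)
    obtain rfl := (hL (n - m)).eq hrefl hl hl'
      (h1.equiv_right_of_tprod_comp h3 h3' _ _ (exists_proj_eq h fI) ψ)
    rfl
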